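/- Let $G=(V,E,c)$ be a finite undirected graph with $n=|V|\ge 1$ vertices and a positive edge cost function $c$. The cost of a cut $(S,V\setminus S)$ is $c(S,V\setminus S)=\sum_{\{x,y\}\in E,\,x\in S,\,y\notin S}c(\{x,y\})$. For vertices $s\neq t$ let the source community $\mathcal{SC}(s,t)\subseteq V$ be the side containing $s$ of the (unique) minimum $s$-$t$-cut that minimizes the number of vertices on the side containing $s$. (a) There exists a rooted cut tree $\mathcal T=(V,E_{\mathcal T},c_{\mathcal T})$ of $G$ with edges directed to the leaves such that each edge $(t,s)\in E_{\mathcal T}$ represents $\mathcal{SC}(s,t)$, and $|\mathcal{SC}(s,t)|\le|\mathcal{SC}(t,s)|$. That is, $\mathcal T$ is a tree on $V$ whose edges are directed away from a root; for each edge $(t,s)$ the component of $s$ in $\mathcal T$ minus that edge is $\mathcal{SC}(s,t)$, which is the $s$-side of a minimum $s$-$t$-cut of $G$; and $c_{\mathcal T}(t,s)$ is the cost of this cut. (b) Such a tree can be constructed by $n-1$ maximum flow computations, namely by the following algorithm of Gomory and Hu with smallest community cuts. Start with the tree with the single node $V$. While some node $S$ has more than one vertex, choose any $u\ne v$ in $S$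 and compute any maximum $u$-$v$-flow in $G$; let $X$ be the set of vertices reachable from $u$, and $Y$ the set of vertices from which $v$ is reachable, in the residual network; let $U=X$ if $|X|\le|Y|$ and $U=Y$ otherwise. Replace $S$ by $S\cap U$ and $S\setminus U$, joined by an edge directed to $S\cap U$ whose cost is the value of the flow, and reconnect each former edge at $S$, with its direction and cost, to $S\cap U$ if the subtree of $S$ at the other end of the edge lies in $U$, and to $S\setminus U$ otherwise. For all choices, the following holds. The algorithm stops after exactly $n-1$ maximum flow computations with a tree as in (a). In each step $X=\mathcal{SC}(u,v)$ and $Y=\mathcal{SC}(v,u)$, and each subtree of $S$ is contained in $U$ or disjoint from $U$. The chosen sides $U$ of all steps are pairwise nested or disjoint (so the chosen cuts are non-crossing), and the cut sides represented by the edges of the final tree are exactly the chosen sides. -/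

import Mathlib

/-- An undirected weighted graph: a simple graph with a positive cost on every edge. -/
structure WeightedGraph (V : Type*) where
  graph : SimpleGraph V
  edgeCost : Sym2 V → ℝ
  edgeCost_pos : ∀ e ∈ graph.edgeSet, 0 < edgeCost e

namespace WeightedGraph

open Classical in
/-- The cost `c(x,y)` of the edge `{x,y}`, and `0` if there is no such edge. -/
noncomputable def cap {V : Type*} (G : WeightedGraph V) (x y : V) : ℝ :=
  if G.graph.Adj x y then G.edgeCost s(x, y) else 0

/-- The cost `c(A,B)` of the edges between two disjoint vertex sets. -/
noncomputable def between {V : Type*} (G : WeightedGraph V) (A B : Finset V) : ℝ :=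
  ∑ x ∈ A, ∑ y ∈ B, G.cap x y

/-- The cost `c(S, V \ S)` of the cut with sides `S` and `V \ S`. -/
noncomputable def cutCost {V : Type*} [Fintype V] [DecidableEq V] (G : WeightedGraph V)
    (S : Finset V) : ℝ :=
  G.between S Sᶜ

/-- `(S, V \ S)` is a minimum `s`-`T`-cut, where `S` is the side of `s`. -/
def IsMinCut {V : Type*} [Fintype V] [DecidableEq V] (G : WeightedGraph V)
    (s : V) (T S : Finset V) : Prop :=
  s ∈ S ∧ Disjoint S T ∧
    ∀ S' : Finset V, s ∈ S' → Disjoint S' T → G.cutCost S ≤ G.cutCost S'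

/-- `(S, V \ S)` is the community cut of `s` with respect to `T`: a minimum `s`-`T`-cut which
minimizes the number of vertices on the side `S` of `s`. -/
def IsCommunityCut {V : Type*} [Fintype V] [DecidableEq V] (G : WeightedGraph V)
    (s : V) (T S : Finset V) : Prop :=
  G.IsMinCut s T S ∧ ∀ S' : Finset V, G.IsMinCut s T S' → S.card ≤ S'.card

theorem cap_nonneg {V : Type*} (G : WeightedGraph V) (x y : V) : 0 ≤ G.cap x y := by
  unfold cap
  split_ifs with h
  · exact (G.edgeCost_pos _ h).le
  · exact le_rfl

theorem cutCost_eq {V : Type*} [Fintype V] [DecidableEq V] (G : WeightedGraph V)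
    (S : Finset V) :
    G.cutCost S = ∑ x, ∑ y, if x ∈ S ∧ y ∉ S then G.cap x y else 0 := by
  unfold cutCost between
  rw [← Finset.sum_filter_add_sum_filter_not Finset.univ (fun x => x ∈ S)
    (fun x => ∑ y, if x ∈ S ∧ y ∉ S then G.cap x y else 0)]
  rw [Finset.sum_eq_zero (s := Finset.univ.filter (fun x => x ∉ S)), add_zero]
  · rw [Finset.filter_mem_eq_inter, Finset.univ_inter]
    refine Finset.sum_congr rfl fun x hx => ?_
    rw [← Finset.sum_filter]
    refine Finset.sum_congr ?_ fun _ _ => rfl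
    ext y
    simp [hx]
  · intro x hx
    have hx' : x ∉ S := by simpa using hx
    simp [hx']

theorem cutCost_submodular {V : Type*} [Fintype V] [DecidableEq V] (G : WeightedGraph V)
    (A B : Finset V) :
    G.cutCost (A ∩ B) + G.cutCost (A ∪ B) ≤ G.cutCost A + G.cutCost B := by
  simp only [cutCost_eq, ← Finset.sum_add_distrib]
  refine Finset.sum_le_sum fun x _ => Finset.sum_le_sum fun y _ => ?_
  have h := G.cap_nonneg x y
  by_cases h1 : x ∈ A <;> by_cases h2 : x ∈ B <;> by_cases h3 : y ∈ A <;>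
    by_cases h4 : y ∈ B <;> simp [h1, h2, h3, h4, h]

/-- The community cut of `s` with respect to `T` exists and is unique. -/
theorem existsUnique_communityCut {V : Type*} [Fintype V] [DecidableEq V]
    (G : WeightedGraph V) {s : V} {T : Finset V} (hs : s ∉ T) :
    ∃! S : Finset V, G.IsCommunityCut s T S := by
  classical
  obtain ⟨S₀, h₀, hmin₀⟩ := Finset.exists_min_image
    (Finset.univ.filter fun S : Finset V => s ∈ S ∧ Disjoint S T) G.cutCost
    ⟨{s}, by simpa using hs⟩
  have hS₀ : G.IsMinCut s T S₀ := by
    have h := (Finset.mem_filter.1 h₀).2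
    exact ⟨h.1, h.2, fun S' h1 h2 => hmin₀ S' (by simp [h1, h2])⟩
  obtain ⟨S, hS, hmin⟩ := Finset.exists_min_image
    (Finset.univ.filter fun S : Finset V => G.IsMinCut s T S) Finset.card
    ⟨S₀, by simpa using hS₀⟩
  have hS' : G.IsMinCut s T S := (Finset.mem_filter.1 hS).2
  have hc : G.IsCommunityCut s T S := ⟨hS', fun S' h => hmin S' (by simpa using h)⟩
  refine ⟨S, hc, fun R hR => ?_⟩
  have hsub := G.cutCost_submodular S R
  have hun := hS'.2.2 (S ∪ R) (Finset.mem_union_left _ hS'.1)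
    (Finset.disjoint_union_left.2 ⟨hS'.2.1, hR.1.2.1⟩)
  have hRS := hS'.2.2 R hR.1.1 hR.1.2.1
  have hint : G.IsMinCut s T (S ∩ R) :=
    ⟨Finset.mem_inter.2 ⟨hS'.1, hR.1.1⟩,
      Finset.disjoint_of_subset_left Finset.inter_subset_left hS'.2.1,
      fun S' h1 h2 => by
        have := hR.1.2.2 S' h1 h2
        linarith⟩
  have e1 : S ∩ R = S := Finset.eq_of_subset_of_card_le Finset.inter_subset_left (hc.2 _ hint)
  have e2 : S ∩ R = R := Finset.eq_of_subset_of_card_le Finset.inter_subset_right (hR.2 _ hint)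
  rw [← e2, e1]

open Classical in
/-- The source community `SC(s,T)` of `s` with respect to `T`: the side of `s` in the community
cut (for `s ∉ T`; the value for `s ∈ T` is never used). -/
noncomputable def SC {V : Type*} [Fintype V] [DecidableEq V] (G : WeightedGraph V)
    (s : V) (T : Finset V) : Finset V :=
  if h : ∃ S, G.IsCommunityCut s T S then h.choose else ∅

theorem SC_spec {V : Type*} [Fintype V] [DecidableEq V] (G : WeightedGraph V)
    {s : V} {T : Finset V} (hs : s ∉ T) : G.IsCommunityCut s T (G.SC s T) := by
  unfold SC
  rw [dif_pos (G.existsUnique_communityCut hs).exists]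
  exact (G.existsUnique_communityCut hs).exists.choose_spec

/-- A feasible `s`-`t`-flow: skew-symmetric, within the edge costs as capacities in both
directions, and conserved at every vertex other than `s` and `t`. -/
structure IsFlow {V : Type*} [Fintype V] (G : WeightedGraph V) (s t : V)
    (f : V → V → ℝ) : Prop where
  skew : ∀ x y, f x y = -f y x
  le_cap : ∀ x y, f x y ≤ G.cap x y
  conserved : ∀ x, x ≠ s → x ≠ t → ∑ y, f x y = 0

/-- The value of a flow with source `s`. -/
noncomputable def flowValue {V : Type*} [Fintype V] (f : V → V → ℝ) (s : V) : ℝ :=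
  ∑ y, f s y

/-- A maximum `s`-`t`-flow. -/
def IsMaxFlow {V : Type*} [Fintype V] (G : WeightedGraph V) (s t : V)
    (f : V → V → ℝ) : Prop :=
  G.IsFlow s t f ∧ ∀ g, G.IsFlow s t g → flowValue g s ≤ flowValue f s

/-- The arc from `x` to `y` has positive residual capacity under the flow `f`. -/
def Residual {V : Type*} (G : WeightedGraph V) (f : V → V → ℝ) (x y : V) : Prop :=
  f x y < G.cap x y

open Classical in
/-- The vertices which can be reached from `s` in the residual network of `f`. -/
noncomputable def sourceSide {V : Type*} [Fintype V] (G : WeightedGraph V)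
    (f : V → V → ℝ) (s : V) : Finset V :=
  Finset.univ.filter fun x => Relation.ReflTransGen (G.Residual f) s x

open Classical in
/-- The vertices from which `t` can be reached in the residual network of `f`. -/
noncomputable def sinkSide {V : Type*} [Fintype V] (G : WeightedGraph V)
    (f : V → V → ℝ) (t : V) : Finset V :=
  Finset.univ.filter fun x => Relation.ReflTransGen (G.Residual f) x t

end WeightedGraph

/-- A directed weighted graph on `V`, intended to be a rooted tree; `Edge t s` is the directed
edge `(t,s)` and `cost t s` its cost (meaningful on edges only). -/
structure DirectedTree (V : Type*) where
  Edge : V → V → Prop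
  cost : V → V → ℝ

namespace DirectedTree

/-- The underlying undirected graph. -/
def toSimpleGraph {V : Type*} (D : DirectedTree V) : SimpleGraph V :=
  SimpleGraph.fromRel D.Edge

/-- The underlying graph is a tree and all edges are directed away from the root `r`, towards
the leaves. -/
def IsRootedAt {V : Type*} (D : DirectedTree V) (r : V) : Prop :=
  D.toSimpleGraph.IsTree ∧
    ∀ t s, D.Edge t s → D.toSimpleGraph.dist r s = D.toSimpleGraph.dist r t + 1

open Classical in
/-- The cut side represented by the edge `(t,s)`: the vertices of the connected component of `s`
after the edge `{t,s}` is deleted. -/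
noncomputable def headSide {V : Type*} [Fintype V] (D : DirectedTree V) (t s : V) : Finset V :=
  Finset.univ.filter fun x => (D.toSimpleGraph.deleteEdges {s(t, s)}).Reachable s x

/-- `D` is a rooted cut tree of `G` with edges directed to the leaves: every edge `(t,s)` induces
a minimum `s`-`t`-cut of `G`, and its cost is the cost of this cut. -/
def IsRootedCutTree {V : Type*} [Fintype V] [DecidableEq V] (D : DirectedTree V)
    (G : WeightedGraph V) : Prop :=
  (∃ r, D.IsRootedAt r) ∧
    ∀ t s, D.Edge t s →
      G.IsMinCut s {t} (D.headSide t s) ∧ D.cost t s = G.cutCost (D.headSide t s)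

/-- `D` is a rooted cut tree of `G` in which each edge `(t,s)` represents `SC(s,t)`, and
`|SC(s,t)| ≤ |SC(t,s)|`. -/
def IsSmallestSCTree {V : Type*} [Fintype V] [DecidableEq V] (D : DirectedTree V)
    (G : WeightedGraph V) : Prop :=
  D.IsRootedCutTree G ∧
    ∀ t s, D.Edge t s →
      D.headSide t s = G.SC s {t} ∧ (G.SC s {t}).card ≤ (G.SC t {s}).card

end DirectedTree

/-! The Gomory-Hu algorithm with smallest community cuts. -/

namespace GomoryHu

/-- A directed edge of an intermediate tree, with its cost. -/
structure NodeEdge (V : Type*) where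
  tail : Finset V
  head : Finset V
  cost : ℝ

/-- An intermediate tree: its nodes are vertex sets. -/
structure State (V : Type*) where
  nodes : Set (Finset V)
  edges : Set (NodeEdge V)

/-- The initial tree: a single node, which holds all vertices, and no edges. -/
def State.init (V : Type*) [Fintype V] : State V where
  nodes := {Finset.univ}
  edges := ∅

/-- Adjacency of nodes, disregarding the direction of edges. -/
def State.Adj {V : Type*} (T : State V) (A B : Finset V) : Prop :=
  ∃ e ∈ T.edges, (e.tail = A ∧ e.head = B) ∨ (e.tail = B ∧ e.head = A)

/-- The vertices in the subtree of `S` that contains the neighbour `N` of `S`: the union of all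
nodes which can be reached from `N` without passing through `S`. -/
def State.subtree {V : Type*} (T : State V) (S N : Finset V) : Set V :=
  {x | ∃ M, Relation.ReflTransGen (fun A B => T.Adj A B ∧ B ≠ S) N M ∧ x ∈ M}

open Classical in
/-- The new position of the end `A` of an edge with other end `B`, when the node `S` is split
along the cut side `U`: an end in `S` moves to the part of `S` on the side of the subtree of `B`,
any other end stays. -/
noncomputable def State.reconnect {V : Type*} (T : State V) (S U A B : Finset V) : Finset V :=
  if A = S then (if T.subtree S B ⊆ (U : Set V) then S ∩ U else S \ U) else A

open Classical in
/-- Splits the node `S` along the cut side `U` into `S ∩ U` and `S \ U`. The two parts are joined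
by a new edge of cost `c`, which points to `U`; the former edges at `S` are reconnected. -/
noncomputable def State.split {V : Type*} (T : State V) (S U : Finset V) (c : ℝ) : State V where
  nodes := (T.nodes \ {S}) ∪ {S ∩ U, S \ U}
  edges := insert ⟨S \ U, S ∩ U, c⟩
    ((fun e => ⟨T.reconnect S U e.tail e.head, T.reconnect S U e.head e.tail, e.cost⟩) '' T.edges)

/-- All nodes are unfolded. -/
def State.IsFinal {V : Type*} (T : State V) : Prop :=
  ∀ S ∈ T.nodes, S.card ≤ 1

/-- `D` is the tree on `V` which is read off from `T` by identifying singletons with their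
elements: the edges of `T` are exactly those of `D`, with the same directions and costs. -/
def State.ReadsOff {V : Type*} (T : State V) (D : DirectedTree V) : Prop :=
  T.edges = {e | ∃ t s, D.Edge t s ∧ e = ⟨{t}, {s}, D.cost t s⟩}

/-- A maximum-flow computation: the queried pair and the flow that is returned. -/
structure FlowCall (V : Type*) where
  source : V
  sink : V
  flow : V → V → ℝ

/-- The chosen cut side: the smaller one of the residual sides of the two terminals. -/
noncomputable def FlowCall.side {V : Type*} [Fintype V] (r : FlowCall V) (G : WeightedGraph V) :
    Finset V :=
  if (G.sourceSide r.flow r.source).card ≤ (G.sinkSide r.flow r.sink).card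
  then G.sourceSide r.flow r.source
  else G.sinkSide r.flow r.sink

/-- One step of the algorithm, with exactly one maximum-flow computation in `G`: an arbitrary
pair of distinct vertices in a node `S` is chosen, an arbitrary maximum flow between them is
computed, and `S` is split along the cut side chosen from this flow. -/
inductive Step {V : Type*} [Fintype V] (G : WeightedGraph V) :
    State V → FlowCall V → State V → Prop
  | mk (T : State V) (S : Finset V) (r : FlowCall V)
      (hS : S ∈ T.nodes) (hu : r.source ∈ S) (hv : r.sink ∈ S) (huv : r.source ≠ r.sink)
      (hr : G.IsMaxFlow r.source r.sink r.flow) :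
      Step G T r (T.split S (r.side G) (WeightedGraph.flowValue r.flow r.source))

/-- `Run G L T`: from the initial tree the algorithm can arrive at `T` with exactly the
maximum-flow computations listed in `L` (the latest one first). -/
inductive Run {V : Type*} [Fintype V] (G : WeightedGraph V) :
    List (FlowCall V) → State V → Prop
  | init : Run G [] (State.init V)
  | step {L : List (FlowCall V)} {T T' : State V} {r : FlowCall V} :
      Run G L T → Step G T r T' → Run G (r :: L) T'

end GomoryHu

/-! An intermediate tree is encoded by the laminar family `F` of the sides chosen so far: its nodes
are the classes `cls F x` of vertices that no member of `F` separates, and its edges are the members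
of `F`. The invariant `IsSmallestFamily` says that each `A ∈ F` has a pair `s ∈ A`, `t ∉ A`,
separated by no other member, for which `A` is the community of `s` and no minimum cut has a smaller
side at `t` (`SmallestSide`).

Let `U` be the side chosen for two vertices of one class. Uncrossing by submodularity and
posimodularity shows that `U` crosses no member (`SmallestSide.subset_of_mem`,
`SmallestSide.subset_or_disjoint`), which is why flows in `G` itself, without contraction, suffice.
If `U` separates the pair representing some `A`, one vertex of the pair is exchanged for a terminal
of `U` (`replace_source` and the two `replace_sink` lemmas), so the invariant survives. `U` splits
one class into two nonempty parts and leaves the others intact, so all classes are singletons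
exactly after `n - 1` steps.

At that point the representing pair of each member is an edge of a tree on `V`, and deleting this
edge leaves the member as the component of its head. The residual sets of a maximum flow are the two
communities because no residual path can leave a minimum cut. Existence in (a) is read off from any
complete run. -/

namespace WeightedGraph

/-! ### Uncrossing of minimum cuts -/

section Cuts

variable {V : Type*} [Fintype V] [DecidableEq V] (G : WeightedGraph V)

theorem cap_symm {V : Type*} (G : WeightedGraph V) (x y : V) : G.cap x y = G.cap y x := by
  unfold cap
  rw [Sym2.eq_swap]
  congr 1
  exact propext (G.graph.adj_comm x y)

theorem cutCost_compl (S : Finset V) : G.cutCost Sᶜ = G.cutCost S := by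
  rw [cutCost_eq, cutCost_eq, Finset.sum_comm]
  refine Finset.sum_congr rfl fun x _ => Finset.sum_congr rfl fun y _ => ?_
  rw [G.cap_symm y x]
  simp [and_comm]

/-- Submodularity for `A` and the complement of `B`, as the cost of a cut is symmetric. -/
theorem cutCost_posimodular (A B : Finset V) :
    G.cutCost (A \ B) + G.cutCost (B \ A) ≤ G.cutCost A + G.cutCost B := by
  have h := G.cutCost_submodular A Bᶜ
  have e1 : A ∩ Bᶜ = A \ B := by ext; simp
  have e2 : A ∪ Bᶜ = (B \ A)ᶜ := by ext; simp; tauto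
  rwa [e1, e2, cutCost_compl, cutCost_compl] at h

/-- `A` is the source community of `s` with respect to `t`, and it is not larger than any side of
`t` in a minimum cut between `s` and `t`. -/
structure SmallestSide (s t : V) (A : Finset V) : Prop where
  mem : s ∈ A
  notMem : t ∉ A
  le : ∀ B, s ∈ B → t ∉ B → G.cutCost A ≤ G.cutCost B
  subset : ∀ B, s ∈ B → t ∉ B → G.cutCost B ≤ G.cutCost A → A ⊆ B
  card_le : ∀ C, t ∈ C → s ∉ C → G.cutCost C ≤ G.cutCost A → A.card ≤ C.card

variable {G} {s t u v : V} {A U : Finset V}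

theorem SmallestSide.le' (h : G.SmallestSide s t A) {B : Finset V} (ht : t ∈ B) (hs : s ∉ B) :
    G.cutCost A ≤ G.cutCost B := by
  rw [← G.cutCost_compl B]
  exact h.le _ (by simpa using hs) (by simpa using ht)

theorem SmallestSide.isMinCut (h : G.SmallestSide s t A) : G.IsMinCut s {t} A :=
  ⟨h.mem, by simpa using h.notMem, fun B h1 h2 => h.le B h1 (by simpa using h2)⟩

theorem SmallestSide.isCommunityCut (h : G.SmallestSide s t A) : G.IsCommunityCut s {t} A :=
  ⟨h.isMinCut, fun B hB => Finset.card_le_card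
    (h.subset B hB.1 (by simpa using hB.2.1) (hB.2.2 A h.mem (by simpa using h.notMem)))⟩

theorem SmallestSide.ne (h : G.SmallestSide s t A) : s ≠ t := by
  rintro rfl
  exact h.notMem h.mem

theorem IsCommunityCut.eq_SC {T : Finset V} (h : G.IsCommunityCut s T A) :
    A = G.SC s T := by
  have hs : s ∉ T := Finset.disjoint_left.1 h.1.2.1 h.1.1
  exact (G.existsUnique_communityCut hs).unique h (G.SC_spec hs)

theorem SmallestSide.eq_SC (h : G.SmallestSide s t A) : A = G.SC s {t} :=
  h.isCommunityCut.eq_SC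

/-- By submodularity `A ∩ B` is again a minimum cut. Thus minimality in cardinality becomes
minimality under inclusion, the form that uncrossing needs. -/
theorem IsCommunityCut.subset {T B : Finset V} (h : G.IsCommunityCut s T A) (hs : s ∈ B)
    (hB : Disjoint B T) (hle : G.cutCost B ≤ G.cutCost A) : A ⊆ B := by
  have hsub := G.cutCost_submodular A B
  have hun := h.1.2.2 (A ∪ B) (Finset.mem_union_left _ h.1.1)
    (Finset.disjoint_union_left.2 ⟨h.1.2.1, hB⟩)
  have hint : G.IsMinCut s T (A ∩ B) :=
    ⟨Finset.mem_inter.2 ⟨h.1.1, hs⟩,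
      Finset.disjoint_of_subset_left Finset.inter_subset_left h.1.2.1,
      fun S' h1 h2 => by
        have := h.1.2.2 S' h1 h2
        linarith⟩
  have e := Finset.eq_of_subset_of_card_le Finset.inter_subset_left (h.2 _ hint)
  exact Finset.inter_eq_left.1 e

theorem IsMinCut.cutCost_eq_of_swap {B : Finset V} (hA : G.IsMinCut s {t} A)
    (hB : G.IsMinCut t {s} B) : G.cutCost A = G.cutCost B := by
  obtain ⟨h1, h2, h3⟩ := hA
  obtain ⟨h4, h5, h6⟩ := hB
  simp only [Finset.disjoint_singleton_right] at *
  apply le_antisymm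
  · rw [← G.cutCost_compl B]
    exact h3 _ (by simpa using h5) (by simpa using h4)
  · rw [← G.cutCost_compl A]
    exact h6 _ (by simpa using h2) (by simpa using h1)

theorem SmallestSide.card_le_SC (h : G.SmallestSide s t A) :
    A.card ≤ (G.SC t {s}).card := by
  have hC := G.SC_spec (s := t) (T := {s}) (by simpa using h.ne.symm)
  refine h.card_le _ hC.1.1 (by simpa using hC.1.2.1) ?_
  exact (h.isMinCut.cutCost_eq_of_swap hC.1).ge

theorem IsCommunityCut.smallestSide {B : Finset V} (hA : G.IsCommunityCut s {t} A)
    (hB : G.IsCommunityCut t {s} B) (hle : A.card ≤ B.card) : G.SmallestSide s t A where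
  mem := hA.1.1
  notMem := by simpa using hA.1.2.1
  le C h1 h2 := hA.1.2.2 C h1 (by simpa using h2)
  subset C h1 h2 h3 := hA.subset h1 (by simpa using h2) h3
  card_le C h1 h2 h3 := by
    rw [hA.1.cutCost_eq_of_swap hB.1] at h3
    exact hle.trans (Finset.card_le_card (hB.subset h1 (by simpa using h2) h3))

/-- If `t ∉ U`, then `A ∪ U` competes with `A`, so `A ∩ U` is no dearer than `U` and must contain
it. If `t ∈ U`, the differences `A \ U` and `U \ A` are minimum cut sides at `v` and `t`. This case
is excluded by size, and it is the one that requires the smaller of the two communities. -/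
theorem SmallestSide.subset_of_mem (hA : G.SmallestSide s t A) (hU : G.SmallestSide u v U)
    (hu : u ∈ A) (hv : v ∈ A) : U ⊆ A := by
  by_cases ht : t ∈ U
  · exfalso
    have h := G.cutCost_posimodular A U
    have h1 := hU.le' (B := A \ U) (by simp [hv, hU.notMem]) (by simp [hU.mem])
    have h2 := hA.le' (B := U \ A) (by simp [ht, hA.notMem]) (by simp [hA.mem])
    have h3 := hU.card_le (A \ U) (by simp [hv, hU.notMem]) (by simp [hU.mem]) (by linarith)
    have h4 := hA.card_le (U \ A) (by simp [ht, hA.notMem]) (by simp [hA.mem]) (by linarith)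
    have h5 := Finset.card_sdiff_add_card_inter A U
    have h6 := Finset.card_sdiff_add_card_inter U A
    have h7 : 0 < (A ∩ U).card := Finset.card_pos.2 ⟨u, by simp [hu, hU.mem]⟩
    -- Together `|U| ≤ |A \ U|` and `|A| ≤ |U \ A|` force `A ∩ U` to be empty, but it contains `u`.
    omega
  · have h := G.cutCost_submodular A U
    have h1 := hA.le (A ∪ U) (by simp [hA.mem]) (by simp [ht, hA.notMem])
    have h2 := hU.subset (A ∩ U) (by simp [hu, hU.mem]) (by simp [hU.notMem]) (by linarith)
    exact h2.trans Finset.inter_subset_left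

/-- According to whether `s ∈ U`, uncrossing makes `A ∩ U` or `A \ U` a minimum cut side for `s` and
`t`, and `A` is contained in every such side. -/
theorem SmallestSide.subset_or_disjoint (hA : G.SmallestSide s t A) (hU : G.SmallestSide u v U)
    (hu : u ∉ A) (hv : v ∉ A) : A ⊆ U ∨ Disjoint A U := by
  by_cases hs : s ∈ U
  · left
    have h := G.cutCost_submodular A U
    have h1 := hU.le (A ∪ U) (by simp [hU.mem]) (by simp [hv, hU.notMem])
    have h2 := hA.subset (A ∩ U) (by simp [hA.mem, hs]) (by simp [hA.notMem]) (by linarith)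
    exact h2.trans Finset.inter_subset_right
  · right
    have h := G.cutCost_posimodular A U
    have h1 := hU.le (U \ A) (by simp [hU.mem, hu]) (by simp [hU.notMem])
    have h2 := hA.subset (A \ U) (by simp [hA.mem, hs]) (by simp [hA.notMem]) (by linarith)
    exact Finset.disjoint_left.2 fun x hx => (Finset.mem_sdiff.1 (h2 hx)).2

/-- If the side `U` of a later cut inside `A` takes away the vertex `s` which represents `A`, then
the sink `v` of that cut represents `A` as well. -/
theorem SmallestSide.replace_source (hA : G.SmallestSide s t A) (hU : G.SmallestSide u v U)
    (hu : u ∈ A) (hv : v ∈ A) (hs : s ∈ U) : G.SmallestSide v t A := by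
  have hUA := hA.subset_of_mem hU hu hv
  have htU : t ∉ U := fun h => hA.notMem (hUA h)
  have hAU := hA.le U hs htU
  -- Only `s ∉ B` is of interest. If `u ∈ B`, then `U ∩ B` separates `u` from `v` and `U ∪ B`
  -- separates `s` from `t`; otherwise `B` itself separates `v` from `u`, and `A` costs no more than
  -- `U`.
  have hle : ∀ B, v ∈ B → t ∉ B → G.cutCost A ≤ G.cutCost B := fun B h1 h2 => by
    by_cases hsB : s ∈ B
    · exact hA.le B hsB h2
    by_cases huB : u ∈ B
    · have h := G.cutCost_submodular U B
      have h3 := hU.le (U ∩ B) (by simp [hU.mem, huB]) (by simp [hU.notMem])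
      have h4 := hA.le (U ∪ B) (by simp [hs]) (by simp [htU, h2])
      linarith
    · exact hAU.trans (hU.le' h1 huB)
  refine ⟨hv, hA.notMem, hle, fun B h1 h2 h3 => ?_, fun C h1 h2 h3 => ?_⟩
  · by_cases hsB : s ∈ B
    · exact hA.subset B hsB h2 h3
    exfalso
    by_cases huB : u ∈ B
    · have h := G.cutCost_submodular U B
      have h4 := hA.le (U ∪ B) (by simp [hs]) (by simp [htU, h2])
      have h5 := hU.subset (U ∩ B) (by simp [hU.mem, huB]) (by simp [hU.notMem]) (by linarith)
      exact hsB (Finset.mem_inter.1 (h5 hs)).2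
    · have h4 := hU.le' h1 huB
      exact hU.notMem (hA.subset U hs htU (by linarith) hv)
  · by_cases hsC : s ∈ C
    · by_cases huC : u ∈ C
      · exfalso
        have h := G.cutCost_submodular C U
        have h4 := hU.le (C ∪ U) (by simp [huC]) (by simp [h2, hU.notMem])
        have h5 := hA.subset (C ∩ U) (by simp [hs, hsC]) (by simp [htU]) (by linarith)
        exact h2 (Finset.mem_inter.1 (h5 hv)).1
      · have h := G.cutCost_posimodular C U
        have h4 := hU.le (U \ C) (by simp [huC, hU.mem]) (by simp [hU.notMem])
        have h5 := hA.card_le (C \ U) (by simp [h1, htU]) (by simp [hs]) (by linarith)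
        exact h5.trans (Finset.card_le_card Finset.sdiff_subset)
    · exact hA.card_le C h1 hsC h3

/-- If a later cut side `U ⊇ A` cuts off the vertex `t` which represents the complement of `A`,
then the source `u` of that cut represents it as well. -/
theorem SmallestSide.replace_sink_of_subset (hA : G.SmallestSide s t A)
    (hU : G.SmallestSide u v U) (hu : u ∉ A) (hAU : A ⊆ U) (ht : t ∉ U) :
    G.SmallestSide s u A := by
  have hs : s ∈ U := hAU hA.mem
  have hc := hA.le U hs ht
  have hle : ∀ B, s ∈ B → u ∉ B → G.cutCost A ≤ G.cutCost B := fun B h1 h2 => by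
    by_cases htB : t ∈ B
    · by_cases hvB : v ∈ B
      · exact hc.trans (hU.le' hvB h2)
      · have h := G.cutCost_posimodular U B
        have h3 := hU.le (U \ B) (by simp [hU.mem, h2]) (by simp [hU.notMem])
        have h4 := hA.le' (B := B \ U) (by simp [htB, ht]) (by simp [hs])
        linarith
    · exact hA.le B h1 htB
  refine ⟨hA.mem, hu, hle, fun B h1 h2 h3 => ?_, fun C h1 h2 h3 => ?_⟩
  · have h := G.cutCost_submodular A B
    have h4 := hle (A ∪ B) (by simp [hA.mem]) (by simp [h2, hu])
    have h5 := hA.subset (A ∩ B) (by simp [hA.mem, h1]) (by simp [hA.notMem]) (by linarith)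
    exact h5.trans Finset.inter_subset_right
  · by_cases htC : t ∈ C
    · exact hA.card_le C htC h2 h3
    by_cases hvC : v ∈ C
    -- Here `C \ U` separates `v` from `u` and `U \ C` separates `s` from `t`, which gives `|A| ≤
    -- |U| ≤ |C \ U|`.
    · have h := G.cutCost_posimodular C U
      have h4 := hU.le' (B := C \ U) (by simp [hvC, hU.notMem]) (by simp [hU.mem])
      have h5 := hA.le (U \ C) (by simp [hs, h2]) (by simp [ht])
      have h6 := hU.card_le (C \ U) (by simp [hvC, hU.notMem]) (by simp [hU.mem]) (by linarith)
      have h7 := Finset.card_le_card hAU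
      have h8 := Finset.card_le_card (Finset.sdiff_subset : C \ U ⊆ C)
      omega
    · exact absurd (hU.subset C h1 hvC (by linarith) hs) h2

/-- If a later cut side `U` disjoint from `A` takes away the vertex `t` which represents the
complement of `A`, then the sink `v` of that cut represents it as well. -/
theorem SmallestSide.replace_sink_of_disjoint (hA : G.SmallestSide s t A)
    (hU : G.SmallestSide u v U) (hv : v ∉ A) (hAU : Disjoint A U) (ht : t ∈ U) :
    G.SmallestSide s v A := by
  have hs : s ∉ U := Finset.disjoint_left.1 hAU hA.mem
  have hc := hA.le' ht hs
  have hle : ∀ B, s ∈ B → v ∉ B → G.cutCost A ≤ G.cutCost B := fun B h1 h2 => by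
    by_cases htB : t ∈ B
    · by_cases huB : u ∈ B
      · exact hc.trans (hU.le B huB h2)
      · have h := G.cutCost_posimodular U B
        have h3 := hU.le (U \ B) (by simp [hU.mem, huB]) (by simp [hU.notMem])
        have h4 := hA.le (B \ U) (by simp [h1, hs]) (by simp [ht])
        linarith
    · exact hA.le B h1 htB
  refine ⟨hA.mem, hv, hle, fun B h1 h2 h3 => ?_, fun C h1 h2 h3 => ?_⟩
  · have h := G.cutCost_submodular A B
    have h4 := hle (A ∪ B) (by simp [hA.mem]) (by simp [h2, hv])
    have h5 := hA.subset (A ∩ B) (by simp [hA.mem, h1]) (by simp [hA.notMem]) (by linarith)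
    exact h5.trans Finset.inter_subset_right
  · by_cases htC : t ∈ C
    · exact hA.card_le C htC h2 h3
    by_cases huC : u ∈ C
    · exfalso
      have h := G.cutCost_submodular C U
      have h4 := hA.le' (B := C ∪ U) (by simp [ht]) (by simp [h2, hs])
      have h5 := hU.subset (C ∩ U) (by simp [huC, hU.mem]) (by simp [hU.notMem]) (by linarith)
      exact htC (Finset.mem_inter.1 (h5 ht)).1
    -- `U` is itself a side at `t` and `C` a side at `v` against `u`, so the sizes compare through
    -- `U`.
    · have h4 := hU.le' h1 huC
      exact (hA.card_le U ht hs (by linarith)).trans (hU.card_le C h1 huC (by linarith))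

end Cuts

end WeightedGraph

/-! ### Maximum flows and residual networks -/

namespace WeightedGraph

section Flows

variable {V : Type*} [Fintype V] {G : WeightedGraph V} {s t : V} {f : V → V → ℝ}

theorem IsFlow.sum_sum_eq_zero (hf : G.IsFlow s t f) (A : Finset V) :
    ∑ x ∈ A, ∑ y ∈ A, f x y = 0 := by
  have h : ∑ x ∈ A, ∑ y ∈ A, f x y = -∑ x ∈ A, ∑ y ∈ A, f x y := by
    conv_lhs => rw [Finset.sum_comm]
    simp only [← Finset.sum_neg_distrib]
    exact Finset.sum_congr rfl fun x _ => Finset.sum_congr rfl fun y _ => hf.skew y x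
  linarith

theorem IsFlow.flowValue_eq [DecidableEq V] (hf : G.IsFlow s t f) {A : Finset V} (hs : s ∈ A)
    (ht : t ∉ A) : flowValue f s = ∑ x ∈ A, ∑ y ∈ Aᶜ, f x y := by
  have h1 : ∑ x ∈ A, ∑ y, f x y = flowValue f s :=
    Finset.sum_eq_single_of_mem s hs fun x hx hxs =>
      hf.conserved x hxs (by rintro rfl; exact ht hx)
  have h2 : ∀ x, ∑ y, f x y = ∑ y ∈ A, f x y + ∑ y ∈ Aᶜ, f x y :=
    fun x => (Finset.sum_add_sum_compl A _).symm
  simp only [h2, Finset.sum_add_distrib, hf.sum_sum_eq_zero, zero_add] at h1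
  exact h1.symm

theorem IsFlow.flowValue_le [DecidableEq V] (hf : G.IsFlow s t f) {A : Finset V} (hs : s ∈ A)
    (ht : t ∉ A) : flowValue f s ≤ G.cutCost A := by
  rw [hf.flowValue_eq hs ht]
  exact Finset.sum_le_sum fun x _ => Finset.sum_le_sum fun y _ => hf.le_cap x y

theorem IsFlow.saturated [DecidableEq V] (hf : G.IsFlow s t f) {A : Finset V} (hs : s ∈ A)
    (ht : t ∉ A) (h : G.cutCost A ≤ flowValue f s) {x y : V} (hx : x ∈ A) (hy : y ∉ A) :
    ¬ G.Residual f x y := by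
  intro hr
  refine absurd h (not_le.2 ?_)
  rw [hf.flowValue_eq hs ht]
  refine Finset.sum_lt_sum (fun x _ => Finset.sum_le_sum fun y _ => hf.le_cap x y) ⟨x, hx, ?_⟩
  exact Finset.sum_lt_sum (fun y _ => hf.le_cap x y) ⟨y, by simpa using hy, hr⟩

theorem IsFlow.cutCost_eq_of_saturated [DecidableEq V] (hf : G.IsFlow s t f) {A : Finset V}
    (hs : s ∈ A) (ht : t ∉ A) (h : ∀ x ∈ A, ∀ y ∉ A, ¬ G.Residual f x y) :
    G.cutCost A = flowValue f s := by
  rw [hf.flowValue_eq hs ht]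
  refine Finset.sum_congr rfl fun x hx => Finset.sum_congr rfl fun y hy => ?_
  exact le_antisymm (not_lt.1 (h x hx y (by simpa using hy))) (hf.le_cap x y)

/-- The real flows form a nonempty compact set, on which the value is continuous. -/
theorem exists_isMaxFlow (G : WeightedGraph V) (s t : V) : ∃ f, G.IsMaxFlow s t f := by
  let K : Set (V → V → ℝ) := {f | G.IsFlow s t f}
  have hK : K = {f | ∀ x y, f x y = -f y x} ∩ ({f | ∀ x y, f x y ≤ G.cap x y} ∩
      {f | ∀ x, x ≠ s → x ≠ t → ∑ y, f x y = 0}) := by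
    ext f
    exact ⟨fun h => ⟨h.1, h.2, h.3⟩, fun h => ⟨h.1, h.2.1, h.2.2⟩⟩
  have hclosed : IsClosed K := by
    rw [hK]
    simp only [Set.ofPred_forall]
    refine IsClosed.inter ?_ (IsClosed.inter ?_ ?_)
    · exact isClosed_iInter fun x => isClosed_iInter fun y =>
        isClosed_eq (by fun_prop) (by fun_prop)
    · exact isClosed_iInter fun x => isClosed_iInter fun y =>
        isClosed_le (by fun_prop) (by fun_prop)
    · exact isClosed_iInter fun x => isClosed_iInter fun _ => isClosed_iInter fun _ =>
        isClosed_eq (by fun_prop) (by fun_prop)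
  have hsub : K ⊆ Set.Icc (fun x y => -G.cap y x) G.cap := fun f hf =>
    ⟨fun x y => by
      have h1 := hf.skew x y
      have h2 := hf.le_cap y x
      show -G.cap y x ≤ f x y
      linarith, fun x y => hf.le_cap x y⟩
  have hcomp : IsCompact K := isCompact_Icc.of_isClosed_subset hclosed hsub
  have hne : K.Nonempty := ⟨fun _ _ => 0, by simp, fun x y => G.cap_nonneg x y, by simp⟩
  obtain ⟨f, hf, hmax⟩ := hcomp.exists_isMaxOn hne
    (f := fun f => flowValue f s) (by unfold flowValue; fun_prop)
  exact ⟨f, hf, fun g hg => hmax hg⟩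

/-- A unit flow from `s` to `x` along residual arcs. -/
theorem exists_residual_unit_flow [DecidableEq V] {x : V}
    (h : Relation.ReflTransGen (G.Residual f) s x) :
    ∃ d : V → V → ℝ, (∀ z w, d z w = -d w z) ∧ (∀ z w, 0 < d z w → G.Residual f z w) ∧
      ∀ z, ∑ w, d z w = (if z = s then 1 else 0) - (if z = x then 1 else 0) := by
  induction h with
  | refl => exact ⟨fun _ _ => 0, by simp, by simp, by simp⟩
  | @tail x y _ hxy ih =>
    obtain ⟨d, h1, h2, h3⟩ := ih
    refine ⟨fun z w => d z w + ((if z = x ∧ w = y then 1 else 0) -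
      (if z = y ∧ w = x then 1 else 0)), fun z w => ?_, fun z w hzw => ?_, fun z => ?_⟩
    · beta_reduce
      simp only [h1 z w, and_comm (a := w = x), and_comm (a := w = y)]
      ring
    · beta_reduce at hzw
      by_cases h : z = x ∧ w = y
      · rw [h.1, h.2]
        exact hxy
      -- Off the new arc the added term is at most zero, so `d z w` was already positive.
      · refine h2 z w ?_
        rw [if_neg h] at hzw
        split_ifs at hzw <;> linarith
    · rw [Finset.sum_add_distrib, h3, Finset.sum_sub_distrib]
      have e : ∀ a b : V, ∑ w, (if z = a ∧ w = b then (1 : ℝ) else 0) = if z = a then 1 else 0 := by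
        intro a b
        by_cases hza : z = a <;> simp [hza]
      rw [e, e]
      ring

theorem IsMaxFlow.not_reachable (hf : G.IsMaxFlow s t f) (hst : s ≠ t) :
    ¬ Relation.ReflTransGen (G.Residual f) s t := by
  classical
  intro h
  obtain ⟨d, h1, h2, h3⟩ := exists_residual_unit_flow h
  -- Arcs with `d x y > 0` have slack, and on all others any positive `ε` is harmless. A small
  -- augmentation suffices for a contradiction, so no bottleneck is computed.
  have hev : ∀ᶠ ε : ℝ in nhdsWithin 0 (Set.Ioi 0), ∀ x y, f x y + ε * d x y ≤ G.cap x y := by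
    refine Filter.eventually_all.2 fun x => Filter.eventually_all.2 fun y => ?_
    by_cases hd : 0 < d x y
    · have hc : Filter.Tendsto (fun ε : ℝ => f x y + ε * d x y) (nhdsWithin 0 (Set.Ioi 0))
          (nhds (f x y + 0 * d x y)) :=
        (Continuous.tendsto (by fun_prop) 0).mono_left nhdsWithin_le_nhds
      have hr : f x y + 0 * d x y < G.cap x y := by
        rw [zero_mul, add_zero]
        exact h2 x y hd
      exact (hc.eventually (gt_mem_nhds hr)).mono fun _ h => le_of_lt h
    · filter_upwards [self_mem_nhdsWithin] with ε hε
      have h4 := mul_nonpos_of_nonneg_of_nonpos (le_of_lt hε) (not_lt.1 hd)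
      have h5 := hf.1.le_cap x y
      linarith
  obtain ⟨ε, hε, hpos⟩ := (hev.and self_mem_nhdsWithin).exists
  have hsum : ∀ x, ∑ y, (f x y + ε * d x y) = ∑ y, f x y +
      ε * ((if x = s then 1 else 0) - (if x = t then 1 else 0)) := fun x => by
    rw [Finset.sum_add_distrib, ← Finset.mul_sum, h3]
  have hg : G.IsFlow s t fun x y => f x y + ε * d x y :=
    ⟨fun x y => by rw [hf.1.skew x y, h1 x y]; ring, hε, fun x hxs hxt => by
      rw [hsum, hf.1.conserved x hxs hxt, if_neg hxs, if_neg hxt]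
      ring⟩
  have h6 := hf.2 _ hg
  unfold flowValue at h6
  rw [hsum, if_pos rfl, if_neg hst] at h6
  have : 0 < ε := hpos
  linarith

theorem mem_sourceSide {x : V} :
    x ∈ G.sourceSide f s ↔ Relation.ReflTransGen (G.Residual f) s x := by
  simp [sourceSide]

theorem mem_sinkSide {x : V} :
    x ∈ G.sinkSide f t ↔ Relation.ReflTransGen (G.Residual f) x t := by
  simp [sinkSide]

variable [DecidableEq V]

theorem IsMaxFlow.cutCost_sourceSide (hf : G.IsMaxFlow s t f) (hst : s ≠ t) :
    G.cutCost (G.sourceSide f s) = flowValue f s := by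
  refine hf.1.cutCost_eq_of_saturated (mem_sourceSide.2 .refl)
    (fun h => hf.not_reachable hst (mem_sourceSide.1 h)) fun x hx y hy hr => hy ?_
  exact mem_sourceSide.2 ((mem_sourceSide.1 hx).tail hr)

theorem IsMaxFlow.cutCost_sinkSide (hf : G.IsMaxFlow s t f) (hst : s ≠ t) :
    G.cutCost (G.sinkSide f t) = flowValue f s := by
  rw [← cutCost_compl]
  refine hf.1.cutCost_eq_of_saturated
    (Finset.mem_compl.2 fun h => hf.not_reachable hst (mem_sinkSide.1 h))
    (by simp [mem_sinkSide, Relation.ReflTransGen.refl]) fun x hx y hy hr => ?_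
  rw [Finset.mem_compl] at hx hy
  exact hx (mem_sinkSide.2 (.head hr (mem_sinkSide.1 (not_not.1 hy))))

/-- The flow saturates every minimum cut, so a residual path from `s` stays inside its source side;
the reachable set is contained in all of them. -/
theorem IsMaxFlow.isCommunityCut_sourceSide (hf : G.IsMaxFlow s t f) (hst : s ≠ t) :
    G.IsCommunityCut s {t} (G.sourceSide f s) := by
  have hc := hf.cutCost_sourceSide hst
  have hmin : G.IsMinCut s {t} (G.sourceSide f s) := by
    refine ⟨mem_sourceSide.2 .refl, Finset.disjoint_singleton_right.2
      fun h => hf.not_reachable hst (mem_sourceSide.1 h), fun B h1 h2 => ?_⟩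
    rw [hc]
    exact hf.1.flowValue_le h1 (by simpa using h2)
  refine ⟨hmin, fun B hB => Finset.card_le_card fun x hx => ?_⟩
  have hBc := hB.2.2 _ hmin.1 hmin.2.1
  rw [hc] at hBc
  have hx' := mem_sourceSide.1 hx
  clear hx
  induction hx' with
  | refl => exact hB.1
  | tail _ hr ih =>
    by_contra hy
    exact hf.1.saturated hB.1 (by simpa using hB.2.1) hBc ih hy hr

theorem IsMaxFlow.isCommunityCut_sinkSide (hf : G.IsMaxFlow s t f) (hst : s ≠ t) :
    G.IsCommunityCut t {s} (G.sinkSide f t) := by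
  have hc := hf.cutCost_sinkSide hst
  have hmin : G.IsMinCut t {s} (G.sinkSide f t) := by
    refine ⟨mem_sinkSide.2 .refl, Finset.disjoint_singleton_right.2
      fun h => hf.not_reachable hst (mem_sinkSide.1 h), fun B h1 h2 => ?_⟩
    rw [hc, ← cutCost_compl]
    exact hf.1.flowValue_le (by simpa using h2) (by simpa using h1)
  refine ⟨hmin, fun B hB => Finset.card_le_card fun x hx => ?_⟩
  have hBc := hB.2.2 _ hmin.1 hmin.2.1
  rw [hc, ← cutCost_compl] at hBc
  have hx' := mem_sinkSide.1 hx
  clear hx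
  induction hx' using Relation.ReflTransGen.head_induction_on with
  | refl => exact hB.1
  | head hr _ ih =>
    by_contra hy
    exact hf.1.saturated (by simpa using hB.2.1) (by simpa using hB.1) hBc
      (Finset.mem_compl.2 hy) (by simpa using ih) hr

end Flows

end WeightedGraph

/-! ### The side chosen from a flow -/

namespace GomoryHu

open WeightedGraph

variable {V : Type*} [Fintype V] [DecidableEq V] {G : WeightedGraph V} {r : FlowCall V}

theorem FlowCall.cutCost_side (hr : G.IsMaxFlow r.source r.sink r.flow)
    (hne : r.source ≠ r.sink) : G.cutCost (r.side G) = flowValue r.flow r.source := by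
  unfold FlowCall.side
  split_ifs
  · exact hr.cutCost_sourceSide hne
  · exact hr.cutCost_sinkSide hne

theorem FlowCall.smallestSide_side (hr : G.IsMaxFlow r.source r.sink r.flow)
    (hne : r.source ≠ r.sink) : G.SmallestSide r.source r.sink (r.side G) ∨
      G.SmallestSide r.sink r.source (r.side G) := by
  have h1 := hr.isCommunityCut_sourceSide hne
  have h2 := hr.isCommunityCut_sinkSide hne
  unfold FlowCall.side
  split_ifs with h
  · exact .inl (h1.smallestSide h2 h)
  · exact .inr (h2.smallestSide h1 (not_le.1 h).le)

end GomoryHu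

/-! Families of vertex sets that encode rooted trees: each member is the vertex set below an
edge. -/

namespace SideFamily

section Classes

variable {V : Type*} {F : Finset (Finset V)} {U : Finset V} {s t x y z : V}

/-- `s ∈ U` and `t ∉ U` are separated by no other member of `F`. -/
def IsLink (F : Finset (Finset V)) (U : Finset V) (t s : V) : Prop :=
  U ∈ F ∧ s ∈ U ∧ t ∉ U ∧ ∀ W ∈ F, W ≠ U → (s ∈ W ↔ t ∈ W)

/-- `U` is the only member of `F` which separates `x` and `y`. -/
def IsAdj (F : Finset (Finset V)) (U : Finset V) (x y : V) : Prop :=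
  IsLink F U x y ∨ IsLink F U y x

/-- `F` is laminar, and each member is the only one separating some pair. -/
structure IsTreeFamily (F : Finset (Finset V)) : Prop where
  laminar : ∀ A ∈ F, ∀ B ∈ F, A ⊆ B ∨ B ⊆ A ∨ Disjoint A B
  linked : ∀ U ∈ F, ∃ t s, IsLink F U t s

theorem IsLink.eq {U' : Finset V} (h : IsLink F U t s) (h' : IsLink F U' t s) : U = U' := by
  by_contra hne
  exact h.2.2.1 ((h'.2.2.2 U h.1 hne).1 h.2.1)

theorem IsAdj.symm (h : IsAdj F U x y) : IsAdj F U y x := Or.symm h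

theorem IsAdj.mem (h : IsAdj F U x y) : U ∈ F := h.elim (fun h => h.1) fun h => h.1

theorem IsAdj.mem_iff_notMem (h : IsAdj F U x y) : x ∈ U ↔ y ∉ U := by
  rcases h with h | h <;> simp [h.2.1, h.2.2.1]

theorem IsAdj.mem_iff (h : IsAdj F U x y) {W : Finset V} (hW : W ∈ F) (hWU : W ≠ U) :
    x ∈ W ↔ y ∈ W := by
  rcases h with h | h
  · exact (h.2.2.2 W hW hWU).symm
  · exact h.2.2.2 W hW hWU

theorem mem_iff_of_reachable {H : SimpleGraph V} (hH : ∀ a b, H.Adj a b → (a ∈ U ↔ b ∈ U))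
    (h : H.Reachable x y) : x ∈ U ↔ y ∈ U := by
  obtain ⟨p⟩ := h
  induction p with
  | nil => rfl
  | cons h _ ih => exact (hH _ _ h).trans ih

theorem IsTreeFamily.subset_of_mem (hF : IsTreeFamily F) {A B : Finset V} (hA : A ∈ F)
    (hB : B ∈ F) (hxA : x ∈ A) (hxB : x ∈ B) (hyA : y ∈ A) (hyB : y ∉ B) : B ⊆ A := by
  rcases hF.laminar A hA B hB with h | h | h
  · exact absurd (h hyA) hyB
  · exact h
  · exact absurd hxB (Finset.disjoint_left.1 h hxA)

/-- `W` contains `t` along with `s`, so laminarity leaves only `U ⊆ W`. This makes the link of a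
member unique up to classes. -/
theorem IsLink.mem_of_mem (hF : IsTreeFamily F) (h : IsLink F U t s) (hx : x ∈ U) {W : Finset V}
    (hW : W ∈ F) (hWU : W ≠ U) (hs : s ∈ W) : x ∈ W :=
  hF.subset_of_mem hW h.1 hs h.2.1 ((h.2.2.2 W hW hWU).1 hs) h.2.2.1 hx

theorem IsLink.unique (hF : IsTreeFamily F) {t' s' : V} (h : IsLink F U t s)
    (h' : IsLink F U t' s') {W : Finset V} (hW : W ∈ F) :
    (s ∈ W ↔ s' ∈ W) ∧ (t ∈ W ↔ t' ∈ W) := by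
  by_cases hWU : W = U
  · subst hWU
    simp [h.2.1, h.2.2.1, h'.2.1, h'.2.2.1]
  · have h1 : s ∈ W ↔ s' ∈ W :=
      ⟨h.mem_of_mem hF h'.2.1 hW hWU, h'.mem_of_mem hF h.2.1 hW hWU⟩
    exact ⟨h1, by rw [← h.2.2.2 W hW hWU, ← h'.2.2.2 W hW hWU, h1]⟩

theorem IsAdj.unique (hF : IsTreeFamily F) {x' y' : V} (h : IsAdj F U x y)
    (h' : IsAdj F U x' y') (hx : x ∈ U ↔ x' ∈ U) {W : Finset V} (hW : W ∈ F) :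
    (x ∈ W ↔ x' ∈ W) ∧ (y ∈ W ↔ y' ∈ W) := by
  rcases h with h | h <;> rcases h' with h' | h'
  · exact (h.unique hF h' hW).symm
  · exact absurd (hx.2 h'.2.1) h.2.2.1
  · exact absurd (hx.1 h.2.1) h'.2.2.1
  · exact h.unique hF h' hW

variable [DecidableEq V]

/-- The members of `F` which separate `x` and `y`. -/
def sep (F : Finset (Finset V)) (x y : V) : Finset (Finset V) :=
  F.filter fun U => ¬ (x ∈ U ↔ y ∈ U)

theorem mem_sep : U ∈ sep F x y ↔ U ∈ F ∧ ¬ (x ∈ U ↔ y ∈ U) := Finset.mem_filter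

/-- Any vertex has a link towards any vertex separated from it. -/
theorem IsTreeFamily.exists_isAdj (hF : IsTreeFamily F) (h : (sep F x y).Nonempty) :
    ∃ U ∈ sep F x y, ∃ z, IsAdj F U x z := by
  -- The path must go up if some member contains `x` but not `y`. The smallest such `W` lies in
  -- every member that contains `x`, so `x` can serve as its head.
  by_cases hxy : ∃ W ∈ F, x ∈ W ∧ y ∉ W
  · obtain ⟨W, hW, hmin⟩ := Finset.exists_min_image (F.filter fun W => x ∈ W ∧ y ∉ W)
      Finset.card (by simpa [Finset.Nonempty] using hxy)
    obtain ⟨hW, hxW, hyW⟩ := Finset.mem_filter.1 hW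
    have hsub : ∀ W' ∈ F, x ∈ W' → W ⊆ W' := fun W' hW' hx' => by
      by_cases hy' : y ∈ W'
      · exact hF.subset_of_mem hW' hW hx' hxW hy' hyW
      · have hc := hmin W' (Finset.mem_filter.2 ⟨hW', hx', hy'⟩)
        rcases hF.laminar W hW W' hW' with h | h | h
        · exact h
        · exact (Finset.eq_of_subset_of_card_le h hc).ge
        · exact absurd hx' (Finset.disjoint_left.1 h hxW)
    obtain ⟨t, s, hl⟩ := hF.linked W hW
    refine ⟨W, mem_sep.2 ⟨hW, by simp [hxW, hyW]⟩, t, .inr ⟨hW, hxW, hl.2.2.1,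
      fun W' hW' hne => ?_⟩⟩
    rw [← hl.2.2.2 W' hW' hne]
    exact ⟨fun hx' => hsub W' hW' hx' hl.2.1, hl.mem_of_mem hF hxW hW' hne⟩
  -- Otherwise the path goes down, into the largest member that contains `y` but not `x`.
  · push Not at hxy
    obtain ⟨U, hU⟩ := h
    have hne : (F.filter fun W => y ∈ W ∧ x ∉ W).Nonempty := by
      obtain ⟨h1, h2⟩ := mem_sep.1 hU
      have := hxy U h1
      exact ⟨U, Finset.mem_filter.2 ⟨h1, by tauto⟩⟩
    obtain ⟨W, hW, hmax⟩ := Finset.exists_max_image _ Finset.card hne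
    obtain ⟨hW, hyW, hxW⟩ := Finset.mem_filter.1 hW
    obtain ⟨t, s, hl⟩ := hF.linked W hW
    refine ⟨W, mem_sep.2 ⟨hW, by simp [hxW, hyW]⟩, s, .inl ⟨hW, hl.2.1, hxW,
      fun W' hW' hne => ⟨fun hs' => ?_, fun hx' => ?_⟩⟩⟩
    · have hsub : W ⊆ W' := fun a ha => hl.mem_of_mem hF ha hW' hne hs'
      by_contra hx'
      have hc := hmax W' (Finset.mem_filter.2 ⟨hW', hsub hyW, hx'⟩)
      exact hne (Finset.eq_of_subset_of_card_le hsub hc).symm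
    · exact hF.subset_of_mem hW' hW (hxy W' hW' hx') hyW hx' hxW hl.2.1

theorem IsAdj.sep_eq_erase (h : IsAdj F U x z) (hU : U ∈ sep F x y) :
    sep F z y = (sep F x y).erase U := by
  ext W
  rw [Finset.mem_erase, mem_sep, mem_sep]
  by_cases hWU : W = U
  · subst hWU
    have h1 := h.mem_iff_notMem
    have h2 := (mem_sep.1 hU).2
    tauto
  · by_cases hW : W ∈ F
    · simp [hW, hWU, h.mem_iff hW hWU]
    · simp [hW]

theorem IsAdj.card_sep (h : IsAdj F U x z) (hU : U ∈ sep F x y) :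
    (sep F z y).card + 1 = (sep F x y).card := by
  rw [h.sep_eq_erase hU, Finset.card_erase_add_one hU]

theorem IsLink.isLink_insert {W : Finset V} (h : IsLink F W t s) (hU : s ∈ U ↔ t ∈ U) :
    IsLink (insert U F) W t s := by
  refine ⟨Finset.mem_insert_of_mem h.1, h.2.1, h.2.2.1, fun A hA hne => ?_⟩
  rcases Finset.mem_insert.1 hA with rfl | hA
  · exact hU
  · exact h.2.2.2 A hA hne

variable [Fintype V]

/-- The vertices which no member of `F` separates from `x`. -/
def cls (F : Finset (Finset V)) (x : V) : Finset V :=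
  Finset.univ.filter fun y => ∀ U ∈ F, (y ∈ U ↔ x ∈ U)

theorem mem_cls : y ∈ cls F x ↔ ∀ U ∈ F, (y ∈ U ↔ x ∈ U) := by simp [cls]

theorem self_mem_cls (F : Finset (Finset V)) (x : V) : x ∈ cls F x := by simp [mem_cls]

theorem cls_eq_iff : cls F x = cls F y ↔ ∀ U ∈ F, (x ∈ U ↔ y ∈ U) := by
  constructor
  · intro h
    exact mem_cls.1 (h ▸ self_mem_cls F x)
  · intro h
    ext z
    rw [mem_cls, mem_cls]
    exact forall₂_congr fun U hU => by rw [h U hU]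

theorem cls_eq_of_mem (h : y ∈ cls F x) : cls F y = cls F x := cls_eq_iff.2 (mem_cls.1 h)

theorem sep_nonempty (h : cls F x ≠ cls F y) : (sep F x y).Nonempty := by
  rw [Ne, cls_eq_iff] at h
  push Not at h
  obtain ⟨U, hU, h⟩ := h
  exact ⟨U, mem_sep.2 ⟨hU, by tauto⟩⟩

theorem cls_eq_of_sep (h : sep F x y = ∅) : cls F x = cls F y := by
  by_contra hne
  exact (sep_nonempty hne).ne_empty h

theorem IsAdj.cls_unique (hF : IsTreeFamily F) {x' y' : V} (h : IsAdj F U x y)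
    (h' : IsAdj F U x' y') (hx : x ∈ U ↔ x' ∈ U) :
    cls F x = cls F x' ∧ cls F y = cls F y' :=
  ⟨cls_eq_iff.2 fun _ hW => (h.unique hF h' hx hW).1,
    cls_eq_iff.2 fun _ hW => (h.unique hF h' hx hW).2⟩

/-- A vertex in the fewest members lies in none: the tail of the smallest member around it would lie
in strictly fewer. -/
theorem IsTreeFamily.exists_root [Nonempty V] (hF : IsTreeFamily F) :
    ∃ r, ∀ U ∈ F, r ∉ U := by
  obtain ⟨r, -, hr⟩ := Finset.exists_min_image Finset.univ
    (fun x => (F.filter fun U => x ∈ U).card) Finset.univ_nonempty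
  refine ⟨r, fun U hU hrU => ?_⟩
  obtain ⟨W, hW, hmin⟩ := Finset.exists_min_image (F.filter fun U => r ∈ U) Finset.card
    ⟨U, Finset.mem_filter.2 ⟨hU, hrU⟩⟩
  obtain ⟨hWF, hrW⟩ := Finset.mem_filter.1 hW
  obtain ⟨t, s, hl⟩ := hF.linked W hWF
  refine absurd (hr t (Finset.mem_univ t)) (not_le.2 (Finset.card_lt_card ?_))
  refine Finset.ssubset_iff_subset_ne.2 ⟨fun W' hW' => ?_, fun he => ?_⟩
  · obtain ⟨hW'F, htW'⟩ := Finset.mem_filter.1 hW'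
    have hne : W' ≠ W := by
      rintro rfl
      exact hl.2.2.1 htW'
    refine Finset.mem_filter.2 ⟨hW'F, hl.mem_of_mem hF hrW hW'F hne ?_⟩
    exact (hl.2.2.2 W' hW'F hne).2 htW'
  · rw [← he] at hW
    exact hl.2.2.1 (Finset.mem_filter.1 hW).2

end Classes

/-! ### The directed tree of a family whose classes are singletons -/

section Tree

variable {V : Type*} [Fintype V] [DecidableEq V] {F : Finset (Finset V)} {U : Finset V}
  {s t x y : V}

open Classical in
/-- The directed tree encoded by `F`, with the costs of the cuts in `G`. -/
noncomputable def toDirectedTree (G : WeightedGraph V) (F : Finset (Finset V)) :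
    DirectedTree V where
  Edge t s := ∃ U, IsLink F U t s
  cost t s := if h : ∃ U, IsLink F U t s then G.cutCost h.choose else 0

variable {G : WeightedGraph V}

theorem IsLink.toDirectedTree_cost (h : IsLink F U t s) :
    (toDirectedTree G F).cost t s = G.cutCost U := by
  have he : ∃ U, IsLink F U t s := ⟨U, h⟩
  exact (dif_pos he).trans (by rw [he.choose_spec.eq h])

theorem toDirectedTree_adj :
    (toDirectedTree G F).toSimpleGraph.Adj x y ↔ ∃ U, IsAdj F U x y := by
  simp only [DirectedTree.toSimpleGraph, SimpleGraph.fromRel_adj, toDirectedTree, IsAdj,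
    exists_or]
  refine and_iff_right_of_imp ?_
  rintro (⟨U, h⟩ | ⟨U, h⟩) rfl <;> exact h.2.2.1 h.2.1

/-- Each step along a link removes one separating member. `H` needs only the links of members
separating `x` and `y`, so that the lemma also applies after an edge is deleted. -/
theorem exists_walk_length_eq (hF : IsTreeFamily F)
    (hinj : Function.Injective (cls F)) {H : SimpleGraph V}
    (hH : ∀ U ∈ sep F x y, ∀ a b, IsAdj F U a b → H.Adj a b) :
    ∃ p : H.Walk x y, p.length = (sep F x y).card := by
  induction hn : (sep F x y).card generalizing x with
  | zero =>
    obtain rfl := hinj (cls_eq_of_sep (Finset.card_eq_zero.1 hn))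
    exact ⟨.nil, rfl⟩
  | succ n ih =>
    obtain ⟨U, hU, z, hz⟩ := hF.exists_isAdj (Finset.card_pos.1 (by omega : 0 < (sep F x y).card))
    have hc := hz.card_sep hU
    obtain ⟨p, hp⟩ := ih (x := z) (fun W hW => hH W
      (Finset.mem_of_mem_erase (hz.sep_eq_erase hU ▸ hW))) (by omega)
    exact ⟨.cons (hH U hU x z hz) p, by simp [hp]⟩

theorem card_sep_le_length (p : (toDirectedTree G F).toSimpleGraph.Walk x y) :
    (sep F x y).card ≤ p.length := by
  induction p with
  | nil => simp [sep]
  | @cons x z y h p ih =>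
    obtain ⟨U, hU⟩ := toDirectedTree_adj.1 h
    have hsub : sep F x y ⊆ insert U (sep F z y) := fun W hW => by
      rw [Finset.mem_insert]
      by_cases hWU : W = U
      · exact .inl hWU
      · obtain ⟨h1, h2⟩ := mem_sep.1 hW
        exact .inr (mem_sep.2 ⟨h1, by rwa [← hU.mem_iff h1 hWU]⟩)
    have h1 := Finset.card_le_card hsub
    have h2 := Finset.card_insert_le U (sep F z y)
    rw [SimpleGraph.Walk.length_cons]
    omega

theorem dist_toDirectedTree (hF : IsTreeFamily F)
    (hinj : Function.Injective (cls F)) :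
    (toDirectedTree G F).toSimpleGraph.dist x y = (sep F x y).card := by
  obtain ⟨p, hp⟩ := exists_walk_length_eq hF hinj (x := x) (y := y)
    (H := (toDirectedTree G F).toSimpleGraph) fun U _ a b h => toDirectedTree_adj.2 ⟨U, h⟩
  refine le_antisymm (hp ▸ SimpleGraph.dist_le p) ?_
  obtain ⟨q, hq⟩ := p.reachable.exists_walk_length_eq_dist
  exact hq ▸ card_sep_le_length q

theorem IsLink.mem_iff_of_deleteEdges_reachable (hF : IsTreeFamily F)
    (hinj : Function.Injective (cls F)) (h : IsLink F U t s)
    (hr : ((toDirectedTree G F).toSimpleGraph.deleteEdges {s(t, s)}).Reachable x y) :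
    x ∈ U ↔ y ∈ U := by
  refine mem_iff_of_reachable (fun a b hab => ?_) hr
  rw [SimpleGraph.deleteEdges_adj, toDirectedTree_adj] at hab
  obtain ⟨⟨W, hW⟩, hne⟩ := hab
  by_cases hWU : U = W
  · subst hWU
    refine absurd ?_ hne
    rw [Set.mem_singleton_iff]
    rcases hW with hW | hW
    · rw [hinj (cls_eq_iff.2 fun A hA => (hW.unique hF h hA).1),
        hinj (cls_eq_iff.2 fun A hA => (hW.unique hF h hA).2)]
    · rw [hinj (cls_eq_iff.2 fun A hA => (hW.unique hF h hA).1),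
        hinj (cls_eq_iff.2 fun A hA => (hW.unique hF h hA).2), Sym2.eq_swap]
  · exact hW.mem_iff h.1 hWU

theorem IsLink.headSide_eq (hF : IsTreeFamily F)
    (hinj : Function.Injective (cls F)) (h : IsLink F U t s) :
    (toDirectedTree G F).headSide t s = U := by
  ext x
  simp only [DirectedTree.headSide, Finset.mem_filter, Finset.mem_univ, true_and]
  constructor
  · intro hr
    exact (h.mem_iff_of_deleteEdges_reachable hF hinj hr).1 h.2.1
  · intro hx
    refine (exists_walk_length_eq hF hinj fun W hW a b hab => ?_).choose.reachable
    have hWU : W ≠ U := by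
      rintro rfl
      exact (mem_sep.1 hW).2 (by simp [hx, h.2.1])
    rw [SimpleGraph.deleteEdges_adj, toDirectedTree_adj]
    refine ⟨⟨W, hab⟩, fun he => ?_⟩
    have hab' := hab.mem_iff_notMem
    have hts := h.2.2.2 W hab.mem hWU
    rcases Sym2.eq_iff.1 (Set.mem_singleton_iff.1 he) with ⟨rfl, rfl⟩ | ⟨rfl, rfl⟩ <;> tauto

/-- Every edge is a bridge, since membership in its `U` is constant along all other edges. -/
theorem isTree_toDirectedTree (hF : IsTreeFamily F)
    (hinj : Function.Injective (cls F)) [Nonempty V] :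
    (toDirectedTree G F).toSimpleGraph.IsTree := by
  refine ⟨⟨fun x y => ?_⟩, ?_⟩
  · exact (exists_walk_length_eq hF hinj
      fun U _ a b h => toDirectedTree_adj.2 ⟨U, h⟩).choose.reachable
  · rw [SimpleGraph.isAcyclic_iff_forall_adj_isBridge]
    intro a b hab
    obtain ⟨U, hU⟩ := toDirectedTree_adj.1 hab
    rw [SimpleGraph.isBridge_iff]
    intro hr
    rcases hU with hU | hU
    · exact hU.2.2.1 ((hU.mem_iff_of_deleteEdges_reachable hF hinj hr).2 hU.2.1)
    · rw [Sym2.eq_swap] at hr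
      exact hU.2.2.1 ((hU.mem_iff_of_deleteEdges_reachable hF hinj hr).1 hU.2.1)

theorem exists_isRootedAt_toDirectedTree (hF : IsTreeFamily F)
    (hinj : Function.Injective (cls F)) [Nonempty V] :
    ∃ r, (toDirectedTree G F).IsRootedAt r := by
  obtain ⟨r, hr⟩ := hF.exists_root
  refine ⟨r, isTree_toDirectedTree hF hinj, ?_⟩
  rintro t s ⟨U, h⟩
  rw [SimpleGraph.dist_comm (u := r), SimpleGraph.dist_comm (u := r),
    dist_toDirectedTree hF hinj, dist_toDirectedTree hF hinj]
  -- As `r` lies in no member, the depth of a vertex is the number of members that contain it.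
  exact (IsAdj.card_sep (.inr h) (mem_sep.2 ⟨h.1, by simp [h.2.1, hr U h.1]⟩)).symm

end Tree

end SideFamily

/-! ### Inserting a new smallest side -/

namespace SideFamily

open WeightedGraph

variable {V : Type*} [Fintype V] [DecidableEq V] {G : WeightedGraph V} {F : Finset (Finset V)}
  {U W : Finset V} {a b x y t s : V}

/-- `F` is laminar, and each member is the smallest side of a minimum cut between two vertices
which no other member separates. -/
structure IsSmallestFamily (G : WeightedGraph V) (F : Finset (Finset V)) : Prop where
  laminar : ∀ A ∈ F, ∀ B ∈ F, A ⊆ B ∨ B ⊆ A ∨ Disjoint A B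
  linked : ∀ U ∈ F, ∃ t s, IsLink F U t s ∧ G.SmallestSide s t U

theorem IsSmallestFamily.isTreeFamily (hF : IsSmallestFamily G F) : IsTreeFamily F where
  laminar := hF.laminar
  linked U hU := by
    obtain ⟨t, s, h, -⟩ := hF.linked U hU
    exact ⟨t, s, h⟩

theorem isSmallestFamily_empty (G : WeightedGraph V) : IsSmallestFamily G ∅ :=
  ⟨by simp, by simp⟩

theorem IsSmallestFamily.subset_of_mem (hF : IsSmallestFamily G F) (hU : G.SmallestSide a b U)
    (hab : cls F a = cls F b) (hW : W ∈ F) (ha : a ∈ W) : U ⊆ W := by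
  obtain ⟨t, s, -, h⟩ := hF.linked W hW
  exact h.subset_of_mem hU ha ((cls_eq_iff.1 hab W hW).1 ha)

theorem IsSmallestFamily.subset_or_disjoint (hF : IsSmallestFamily G F)
    (hU : G.SmallestSide a b U) (hab : cls F a = cls F b) (hW : W ∈ F) (ha : a ∉ W) :
    W ⊆ U ∨ Disjoint W U := by
  obtain ⟨t, s, -, h⟩ := hF.linked W hW
  exact h.subset_or_disjoint hU ha fun hb => ha ((cls_eq_iff.1 hab W hW).2 hb)

theorem notMem_of_cls_eq (hU : G.SmallestSide a b U) (hab : cls F a = cls F b) : U ∉ F :=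
  fun h => hU.notMem ((cls_eq_iff.1 hab U h).1 hU.mem)

theorem IsLink.congr (h : IsLink F W t s) (ht : cls F x = cls F t) (hs : cls F y = cls F s) :
    IsLink F W x y := by
  rw [cls_eq_iff] at ht hs
  refine ⟨h.1, (hs W h.1).2 h.2.1, fun hx => h.2.2.1 ((ht W h.1).1 hx), fun A hA hne => ?_⟩
  rw [ht A hA, hs A hA, h.2.2.2 A hA hne]

theorem isLink_insert_self (hU : G.SmallestSide a b U) (hab : cls F a = cls F b) :
    IsLink (insert U F) U b a := by
  refine ⟨Finset.mem_insert_self U F, hU.mem, hU.notMem, fun A hA hne => ?_⟩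
  exact cls_eq_iff.1 hab A ((Finset.mem_insert.1 hA).resolve_left hne)

/-- The pair which represents a member of the family can be adapted to a new member. -/
theorem IsSmallestFamily.exists_isLink_insert (hF : IsSmallestFamily G F)
    (hU : G.SmallestSide a b U) (hab : cls F a = cls F b) (hW : W ∈ F) :
    ∃ t s, IsLink F W t s ∧ IsLink (insert U F) W t s ∧ G.SmallestSide s t W := by
  obtain ⟨t, s, hl, hs⟩ := hF.linked W hW
  have hb := cls_eq_iff.1 hab
  -- Replacing the ends within their classes keeps the link in `F`, so it remains to find such a
  -- pair that `U` does not separate.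
  suffices h : ∃ t' s', cls F t' = cls F t ∧ cls F s' = cls F s ∧ (s' ∈ U ↔ t' ∈ U) ∧
      G.SmallestSide s' t' W by
    obtain ⟨t', s', h1, h2, h3, h4⟩ := h
    exact ⟨t', s', hl.congr h1 h2, (hl.congr h1 h2).isLink_insert h3, h4⟩
  by_cases haW : a ∈ W
  · have hUW := hF.subset_of_mem hU hab hW haW
    have htU : t ∉ U := fun h => hl.2.2.1 (hUW h)
    by_cases hsU : s ∈ U
    · refine ⟨t, b, rfl, ?_, by simp [htU, hU.notMem],
        hs.replace_source hU haW ((hb W hW).1 haW) hsU⟩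
      -- Here `b` may stand in for `s` only if they share a class: a member containing `a` contains
      -- `U`, while one containing `s` but not `a` would contain `t` and so could neither lie in `U`
      -- nor miss it.
      rw [← hab, cls_eq_iff]
      refine fun A hA => ⟨fun h => hF.subset_of_mem hU hab hA h hsU, fun h => ?_⟩
      by_contra haA
      have hne : A ≠ W := fun he => haA (he ▸ haW)
      rcases hF.subset_or_disjoint hU hab hA haA with h' | h'
      · exact htU (h' ((hl.2.2.2 A hA hne).1 h))
      · exact Finset.disjoint_left.1 h' h hsU
    · exact ⟨t, s, rfl, rfl, by simp [htU, hsU], hs⟩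
  · have hbW : b ∉ W := fun h => haW ((hb W hW).2 h)
    rcases hF.subset_or_disjoint hU hab hW haW with hWU | hWU
    · have hsU := hWU hl.2.1
      by_cases htU : t ∈ U
      · exact ⟨t, s, rfl, rfl, by simp [htU, hsU], hs⟩
      refine ⟨a, s, ?_, rfl, by simp [hsU, hU.mem], hs.replace_sink_of_subset hU haW hWU htU⟩
      rw [cls_eq_iff]
      refine fun A hA => ⟨fun h => ?_, fun h => ?_⟩
      · have hne : A ≠ W := fun he => haW (he ▸ h)
        exact (hl.2.2.2 A hA hne).1 (hF.subset_of_mem hU hab hA h hsU)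
      · by_contra haA
        have hne : A ≠ W := fun he => hl.2.2.1 (he ▸ h)
        rcases hF.subset_or_disjoint hU hab hA haA with h' | h'
        · exact htU (h' h)
        · exact Finset.disjoint_left.1 h' ((hl.2.2.2 A hA hne).2 h) hsU
    · have hsU := Finset.disjoint_left.1 hWU hl.2.1
      by_cases htU : t ∈ U
      · refine ⟨b, s, ?_, rfl, by simp [hsU, hU.notMem],
          hs.replace_sink_of_disjoint hU hbW hWU htU⟩
        rw [← hab, cls_eq_iff]
        refine fun A hA => ⟨fun h => hF.subset_of_mem hU hab hA h htU, fun h => ?_⟩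
        by_contra haA
        have hne : A ≠ W := fun he => hl.2.2.1 (he ▸ h)
        rcases hF.subset_or_disjoint hU hab hA haA with h' | h'
        · exact hsU (h' ((hl.2.2.2 A hA hne).2 h))
        · exact Finset.disjoint_left.1 h' h htU
      · exact ⟨t, s, rfl, rfl, by simp [htU, hsU], hs⟩

theorem isSmallestFamily_insert (hF : IsSmallestFamily G F)
    (hU : G.SmallestSide a b U) (hab : cls F a = cls F b) : IsSmallestFamily G (insert U F) := by
  have hcross : ∀ W ∈ F, W ⊆ U ∨ U ⊆ W ∨ Disjoint W U := fun W hW => by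
    by_cases ha : a ∈ W
    · exact .inr (.inl (hF.subset_of_mem hU hab hW ha))
    · exact (hF.subset_or_disjoint hU hab hW ha).imp_right .inr
  refine ⟨fun A hA B hB => ?_, fun W hW => ?_⟩
  · rcases Finset.mem_insert.1 hA with hAU | hAF <;> rcases Finset.mem_insert.1 hB with hBU | hBF
    · exact .inl (hAU.trans hBU.symm).subset
    · rw [hAU]
      rcases hcross B hBF with h | h | h
      · exact .inr (.inl h)
      · exact .inl h
      · exact .inr (.inr h.symm)
    · rw [hBU]
      exact hcross A hAF
    · exact hF.laminar A hAF B hBF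
  · rcases Finset.mem_insert.1 hW with rfl | hW
    · exact ⟨b, a, isLink_insert_self hU hab, hU⟩
    · obtain ⟨t, s, -, h1, h2⟩ := hF.exists_isLink_insert hU hab hW
      exact ⟨t, s, h1, h2⟩

theorem mem_cls_insert : y ∈ cls (insert U F) x ↔ (y ∈ U ↔ x ∈ U) ∧ y ∈ cls F x := by
  simp [mem_cls]

theorem cls_insert_of_mem (hx : x ∈ cls F a) (hxU : x ∈ U) :
    cls (insert U F) x = cls F a ∩ U := by
  ext y
  rw [mem_cls_insert, cls_eq_of_mem hx, Finset.mem_inter]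
  simp [hxU, and_comm]

theorem cls_insert_of_notMem (hx : x ∈ cls F a) (hxU : x ∉ U) :
    cls (insert U F) x = cls F a \ U := by
  ext y
  rw [mem_cls_insert, cls_eq_of_mem hx, Finset.mem_sdiff]
  simp [hxU, and_comm]

/-- Some member separates the class of `x` from `a`; as `U` does not cross it, that class lies
wholly inside or outside `U`. -/
theorem IsSmallestFamily.cls_insert_of_cls_ne (hF : IsSmallestFamily G F)
    (hU : G.SmallestSide a b U) (hab : cls F a = cls F b) (hx : cls F x ≠ cls F a) :
    cls (insert U F) x = cls F x := by
  ext y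
  rw [mem_cls_insert, and_iff_right_of_imp]
  intro hy
  obtain ⟨W, hW⟩ := sep_nonempty hx
  obtain ⟨hW, hxa⟩ := mem_sep.1 hW
  have hyx := mem_cls.1 hy W hW
  by_cases ha : a ∈ W
  · have h := hF.subset_of_mem hU hab hW ha
    have hxW : x ∉ W := by tauto
    have hyW : y ∉ W := by tauto
    exact iff_of_false (fun h' => hyW (h h')) fun h' => hxW (h h')
  · have hxW : x ∈ W := by tauto
    have hyW : y ∈ W := by tauto
    rcases hF.subset_or_disjoint hU hab hW ha with h | h
    · exact iff_of_true (h hyW) (h hxW)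
    · exact iff_of_false (Finset.disjoint_left.1 h hyW) (Finset.disjoint_left.1 h hxW)

theorem IsSmallestFamily.range_cls_insert (hF : IsSmallestFamily G F)
    (hU : G.SmallestSide a b U) (hab : cls F a = cls F b) :
    Set.range (cls (insert U F)) =
      (Set.range (cls F) \ {cls F a}) ∪ {cls F a ∩ U, cls F a \ U} := by
  have hb : b ∈ cls F a := hab ▸ self_mem_cls F b
  ext M
  simp only [Set.mem_range, Set.mem_union, Set.mem_sdiff, Set.mem_insert_iff,
    Set.mem_singleton_iff]
  constructor
  · rintro ⟨x, rfl⟩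
    by_cases hx : cls F x = cls F a
    · have hx' : x ∈ cls F a := hx ▸ self_mem_cls F x
      by_cases hxU : x ∈ U
      · exact .inr (.inl (cls_insert_of_mem hx' hxU))
      · exact .inr (.inr (cls_insert_of_notMem hx' hxU))
    · have h := hF.cls_insert_of_cls_ne hU hab hx
      exact .inl ⟨⟨x, h.symm⟩, h ▸ hx⟩
  · rintro (⟨⟨x, rfl⟩, hx⟩ | rfl | rfl)
    · exact ⟨x, hF.cls_insert_of_cls_ne hU hab hx⟩
    · exact ⟨a, cls_insert_of_mem (self_mem_cls F a) hU.mem⟩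
    · exact ⟨b, cls_insert_of_notMem hb hU.notMem⟩

theorem IsSmallestFamily.ncard_range_cls_insert (hF : IsSmallestFamily G F)
    (hU : G.SmallestSide a b U) (hab : cls F a = cls F b) :
    (Set.range (cls (insert U F))).ncard = (Set.range (cls F)).ncard + 1 := by
  have hb : b ∈ cls F a := hab ▸ self_mem_cls F b
  have ha1 : a ∈ cls F a ∩ U := Finset.mem_inter.2 ⟨self_mem_cls F a, hU.mem⟩
  have hb1 : b ∈ cls F a \ U := Finset.mem_sdiff.2 ⟨hb, hU.notMem⟩
  -- Both parts are nonempty, as witnessed by `a` and `b`, so they are distinct and neither is an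
  -- old class other than that of `a`.
  have hne : cls F a ∩ U ≠ cls F a \ U := fun h => by
    rw [h] at ha1
    exact (Finset.mem_sdiff.1 ha1).2 hU.mem
  have hdisj : Disjoint (Set.range (cls F) \ {cls F a})
      ({cls F a ∩ U, cls F a \ U} : Set (Finset V)) := by
    rw [Set.disjoint_left]
    rintro _ ⟨⟨x, rfl⟩, hx⟩ (h | h)
    · rw [← h] at ha1
      exact hx (cls_eq_of_mem ha1).symm
    · rw [← Set.mem_singleton_iff.1 h] at hb1
      exact hx ((cls_eq_of_mem hb1).symm.trans hab.symm)
  rw [hF.range_cls_insert hU hab, Set.ncard_union_eq hdisj (Set.toFinite _) (Set.toFinite _),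
    Set.ncard_pair hne,
    ← Set.ncard_sdiff_singleton_add_one (Set.mem_range_self a) (Set.toFinite _)]

end SideFamily

/-! ### Splitting a node corresponds to inserting a side -/

namespace GomoryHu

open WeightedGraph SideFamily

section Split

variable {V : Type*} {T : State V} {S U : Finset V}

theorem State.reconnect_of_ne {A B : Finset V} (h : A ≠ S) : T.reconnect S U A B = A :=
  if_neg h

variable [DecidableEq V]

/-- The definition of `State.split` uses classical decidability; this and the next lemmas pass to
the ambient instance. -/
theorem State.split_nodes (T : State V) (S U : Finset V) (c : ℝ) :
    (T.split S U c).nodes = (T.nodes \ {S}) ∪ {S ∩ U, S \ U} := by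
  unfold State.split
  congr!

theorem State.split_edges (T : State V) (S U : Finset V) (c : ℝ) :
    (T.split S U c).edges = insert ⟨S \ U, S ∩ U, c⟩
      ((fun e => ⟨T.reconnect S U e.tail e.head, T.reconnect S U e.head e.tail, e.cost⟩) ''
        T.edges) := by
  unfold State.split
  congr!

theorem State.reconnect_self_of_subset {B : Finset V} (h : T.subtree S B ⊆ U) :
    T.reconnect S U S B = S ∩ U := by
  unfold State.reconnect
  rw [if_pos rfl, if_pos h]
  congr!

theorem State.reconnect_self_of_not_subset {B : Finset V} (h : ¬ T.subtree S B ⊆ U) :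
    T.reconnect S U S B = S \ U := by
  unfold State.reconnect
  rw [if_pos rfl, if_neg h]
  congr!

end Split

variable {V : Type*} [Fintype V] [DecidableEq V] {G : WeightedGraph V} {T : State V}
  {F : Finset (Finset V)} {U W : Finset V} {a b x y : V}

/-- The nodes of `T` are the classes of `F`, and its edges are the members of `F`. -/
structure Encodes (G : WeightedGraph V) (T : State V) (F : Finset (Finset V)) : Prop where
  nodes : T.nodes = Set.range (cls F)
  edges : T.edges = {e | ∃ W t s, IsLink F W t s ∧ e = ⟨cls F t, cls F s, G.cutCost W⟩}

theorem encodes_init [Nonempty V] (G : WeightedGraph V) : Encodes G (State.init V) ∅ := by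
  have h : ∀ x : V, cls ∅ x = Finset.univ := fun x => by ext; simp [mem_cls]
  refine ⟨?_, ?_⟩
  · ext M
    simp [State.init, h, eq_comm]
  · ext e
    simp [State.init, IsLink]

theorem Encodes.adj_iff (hT : Encodes G T F) {A B : Finset V} :
    T.Adj A B ↔ ∃ W x y, IsAdj F W x y ∧ A = cls F x ∧ B = cls F y := by
  unfold State.Adj
  rw [hT.edges]
  constructor
  · rintro ⟨_, ⟨W, t, s, h, rfl⟩, ⟨rfl, rfl⟩ | ⟨rfl, rfl⟩⟩
    · exact ⟨W, t, s, .inl h, rfl, rfl⟩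
    · exact ⟨W, s, t, .inr h, rfl, rfl⟩
  · rintro ⟨W, x, y, h | h, rfl, rfl⟩
    · exact ⟨_, ⟨W, x, y, h, rfl⟩, .inl ⟨rfl, rfl⟩⟩
    · exact ⟨_, ⟨W, y, x, h, rfl⟩, .inr ⟨rfl, rfl⟩⟩

/-- Changing sides of `W` means using its edge, whose other end is the forbidden node `cls F x`.
Conversely, a path that follows separating members never crosses `W`. -/
theorem Encodes.subtree_eq (hT : Encodes G T F) (hF : IsTreeFamily F) (h : IsAdj F W x y) :
    T.subtree (cls F x) (cls F y) = {z | z ∈ W ↔ y ∈ W} := by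
  have hxy := h.mem_iff_notMem
  ext z
  constructor
  · rintro ⟨M, hM, hz⟩
    suffices hs : ∃ w, M = cls F w ∧ (w ∈ W ↔ y ∈ W) by
      obtain ⟨w, rfl, hw⟩ := hs
      exact (mem_cls.1 hz W h.mem).trans hw
    clear hz
    induction hM with
    | refl => exact ⟨y, rfl, Iff.rfl⟩
    | @tail A B _ hAB ih =>
      obtain ⟨w, rfl, hw⟩ := ih
      obtain ⟨hAB, hB⟩ := hAB
      obtain ⟨W', w', z', h', hw', rfl⟩ := hT.adj_iff.1 hAB
      refine ⟨z', rfl, ?_⟩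
      have hww := cls_eq_iff.1 hw' W h.mem
      by_cases hWW : W = W'
      · subst hWW
        exact absurd (h'.symm.cls_unique hF h 
          (h'.symm.mem_iff_notMem.trans (hxy.trans (not_congr (hw.symm.trans hww))).symm)).1 hB
      · rw [← h'.mem_iff h.mem hWW, ← hww, hw]
  · intro hz
    refine ⟨cls F z, ?_, self_mem_cls F z⟩
    have main : ∀ n w, (w ∈ W ↔ y ∈ W) → (sep F w z).card = n →
        Relation.ReflTransGen (fun A B => T.Adj A B ∧ B ≠ cls F x) (cls F w) (cls F z) := by
      intro n
      induction n with
      | zero =>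
        intro w _ hn
        rw [cls_eq_of_sep (Finset.card_eq_zero.1 hn)]
      | succ n ih =>
        intro w hw hn
        obtain ⟨W', hW', z', hz'⟩ :=
          hF.exists_isAdj (Finset.card_pos.1 (by omega : 0 < (sep F w z).card))
        have hne : W ≠ W' := by
          rintro rfl
          exact (mem_sep.1 hW').2 (hw.trans (Iff.symm hz))
        have hzw := hz'.mem_iff h.mem hne
        have hc := hz'.card_sep hW'
        refine .head ⟨hT.adj_iff.2 ⟨W', w, z', hz', rfl, rfl⟩, fun he => ?_⟩
          (ih z' (hzw.symm.trans hw) (by omega))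
        have hzx := cls_eq_iff.1 he W h.mem
        exact iff_not_self ((hzw.symm.trans hw).symm.trans (hzx.trans hxy))
    exact main _ y Iff.rfl rfl

theorem Encodes.subtree_subset_or_disjoint (hT : Encodes G T F) (hF : IsSmallestFamily G F)
    (hU : G.SmallestSide a b U) (hab : cls F a = cls F b) {N : Finset V}
    (hN : T.Adj (cls F a) N) :
    T.subtree (cls F a) N ⊆ U ∨ Disjoint (T.subtree (cls F a) N) (U : Set V) := by
  obtain ⟨W, x, y, h, hx, rfl⟩ := hT.adj_iff.1 hN
  rw [hx, hT.subtree_eq hF.isTreeFamily h, Set.disjoint_left]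
  have hax := cls_eq_iff.1 hx W h.mem
  have hxy := h.mem_iff_notMem
  by_cases hy : y ∈ W
  · rcases hF.subset_or_disjoint hU hab h.mem (by tauto) with h' | h'
    · exact .inl fun z hz => h' (hz.2 hy)
    · exact .inr fun z hz => Finset.disjoint_left.1 h' (hz.2 hy)
  · have h' := hF.subset_of_mem hU hab h.mem (by tauto)
    exact .inr fun z hz hzU => hy (hz.1 (h' hzU))

/-- A pair linked in both families lies on one side of `U`. The subtree at `y` does not cross `U`,
so the test on it decides whether `y`, and hence `x`, is in `U`. -/
theorem Encodes.reconnect_eq (hT : Encodes G T F) (hF : IsSmallestFamily G F)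
    (hU : G.SmallestSide a b U) (hab : cls F a = cls F b) (h : IsAdj F W x y)
    (h' : IsAdj (insert U F) W x y) :
    T.reconnect (cls F a) U (cls F x) (cls F y) = cls (insert U F) x := by
  by_cases hx : cls F x = cls F a
  · have hsub := hT.subtree_subset_or_disjoint hF hU hab (N := cls F y)
      (hT.adj_iff.2 ⟨W, x, y, h, hx.symm, rfl⟩)
    have hy : y ∈ T.subtree (cls F a) (cls F y) := ⟨_, .refl, self_mem_cls F y⟩
    have hUW : U ≠ W := fun he => notMem_of_cls_eq hU hab (he ▸ h.mem)
    have hxy := h'.mem_iff (Finset.mem_insert_self U F) hUW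
    have hxa : x ∈ cls F a := hx ▸ self_mem_cls F x
    rw [hx]
    by_cases hxU : x ∈ U
    · rw [cls_insert_of_mem hxa hxU]
      refine State.reconnect_self_of_subset (hsub.resolve_right fun hd => ?_)
      exact Set.disjoint_left.1 hd hy (hxy.1 hxU)
    · rw [cls_insert_of_notMem hxa hxU]
      exact State.reconnect_self_of_not_subset fun hs => hxU (hxy.2 (hs hy))
  · rw [State.reconnect_of_ne hx, hF.cls_insert_of_cls_ne hU hab hx]

theorem Encodes.split (hT : Encodes G T F) (hF : IsSmallestFamily G F)
    (hU : G.SmallestSide a b U) (hab : cls F a = cls F b) :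
    Encodes G (T.split (cls F a) U (G.cutCost U)) (insert U F) := by
  have hF' := isSmallestFamily_insert hF hU hab
  have hb : b ∈ cls F a := hab ▸ self_mem_cls F b
  have hnew : (⟨cls F a \ U, cls F a ∩ U, G.cutCost U⟩ : NodeEdge V) =
      ⟨cls (insert U F) b, cls (insert U F) a, G.cutCost U⟩ := by
    rw [cls_insert_of_mem (self_mem_cls F a) hU.mem, cls_insert_of_notMem hb hU.notMem]
  have hold : ∀ {W t s}, IsLink F W t s → IsLink (insert U F) W t s →
      (⟨T.reconnect (cls F a) U (cls F t) (cls F s), T.reconnect (cls F a) U (cls F s) (cls F t),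
        G.cutCost W⟩ : NodeEdge V) =
      ⟨cls (insert U F) t, cls (insert U F) s, G.cutCost W⟩ := fun h h' => by
    rw [hT.reconnect_eq hF hU hab (.inl h) (.inl h'),
      hT.reconnect_eq hF hU hab (.inr h) (.inr h')]
  refine ⟨?_, ?_⟩
  · rw [State.split_nodes, hT.nodes, hF.range_cls_insert hU hab]
  · rw [State.split_edges, hT.edges, hnew]
    ext e
    constructor
    · rintro (rfl | ⟨_, ⟨W, t, s, h, rfl⟩, rfl⟩)
      · exact ⟨U, b, a, isLink_insert_self hU hab, rfl⟩
      · obtain ⟨t', s', h1, h2, -⟩ := hF.exists_isLink_insert hU hab h.1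
        have he := IsAdj.cls_unique hF.isTreeFamily (.inl h) (.inl h1)
          (iff_of_false h.2.2.1 h1.2.2.1)
        refine ⟨W, t', s', h2, ?_⟩
        dsimp only
        rw [he.1, he.2, hold h1 h2]
    · rintro ⟨W, t, s, h, rfl⟩
      rcases Finset.mem_insert.1 h.1 with rfl | hW
      · left
        have he := IsAdj.cls_unique hF'.isTreeFamily (.inl h)
          (.inl (isLink_insert_self hU hab)) (iff_of_false h.2.2.1 hU.notMem)
        rw [he.1, he.2]
      · right
        obtain ⟨t', s', h1, h2, -⟩ := hF.exists_isLink_insert hU hab hW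
        have he := IsAdj.cls_unique hF'.isTreeFamily (.inl h) (.inl h2)
          (iff_of_false h.2.2.1 h2.2.2.1)
        refine ⟨_, ⟨W, t', s', h1, rfl⟩, ?_⟩
        rw [he.1, he.2]
        exact hold h1 h2

end GomoryHu

/-! ### Runs of the algorithm -/

namespace GomoryHu

open WeightedGraph SideFamily

variable {V : Type*} [Fintype V] [DecidableEq V] {G : WeightedGraph V} {T : State V}
  {L : List (FlowCall V)} {F : Finset (Finset V)}

/-- The chosen sides `F` of a sequence of maximum-flow computations, and the tree `T` which they
determine. -/
structure IsFamilyOf (G : WeightedGraph V) (L : List (FlowCall V)) (T : State V)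
    (F : Finset (Finset V)) : Prop where
  isSmallestFamily : IsSmallestFamily G F
  encodes : Encodes G T F
  mem_iff : ∀ U, U ∈ F ↔ ∃ r ∈ L, r.side G = U
  ncard : (Set.range (cls F)).ncard = L.length + 1
  isMaxFlow : ∀ r ∈ L, r.source ≠ r.sink ∧ G.IsMaxFlow r.source r.sink r.flow

theorem FlowCall.exists_smallestSide {r : FlowCall V}
    (hr : G.IsMaxFlow r.source r.sink r.flow) (hne : r.source ≠ r.sink) {S : Finset V}
    (hu : r.source ∈ S) (hv : r.sink ∈ S) :
    ∃ a ∈ S, ∃ b ∈ S, G.SmallestSide a b (r.side G) :=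
  (FlowCall.smallestSide_side hr hne).elim (fun h => ⟨_, hu, _, hv, h⟩) fun h => ⟨_, hv, _, hu, h⟩

theorem Encodes.eq_cls (hT : Encodes G T F) {S : Finset V} (hS : S ∈ T.nodes) {a : V}
    (ha : a ∈ S) : S = cls F a := by
  rw [hT.nodes] at hS
  obtain ⟨x, rfl⟩ := hS
  exact (cls_eq_of_mem ha).symm

theorem IsFamilyOf.step (hF : IsFamilyOf G L T F) {r : FlowCall V} {T' : State V}
    (h : Step G T r T') : IsFamilyOf G (r :: L) T' (insert (r.side G) F) := by
  obtain ⟨S, _, hS, hu, hv, huv, hr⟩ := h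
  obtain ⟨a, ha, b, hb, hU⟩ := FlowCall.exists_smallestSide hr huv hu hv
  have hSa := hF.encodes.eq_cls hS ha
  have hab : cls F a = cls F b := hSa ▸ hF.encodes.eq_cls hS hb
  refine ⟨isSmallestFamily_insert hF.isSmallestFamily hU hab, ?_, fun U => ?_, ?_, ?_⟩
  · rw [hSa, ← FlowCall.cutCost_side hr huv]
    exact hF.encodes.split hF.isSmallestFamily hU hab
  · simp only [Finset.mem_insert, hF.mem_iff, List.mem_cons, exists_eq_or_imp, eq_comm (a := U)]
  · rw [hF.isSmallestFamily.ncard_range_cls_insert hU hab, hF.ncard, List.length_cons]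
  · exact List.forall_mem_cons.2 ⟨⟨huv, hr⟩, hF.isMaxFlow⟩

theorem Run.exists_isFamilyOf [Nonempty V] (h : Run G L T) : ∃ F, IsFamilyOf G L T F := by
  induction h with
  | init =>
    have hT := encodes_init G
    refine ⟨∅, isSmallestFamily_empty G, hT, by simp, ?_, by simp⟩
    rw [← hT.nodes]
    exact Set.ncard_singleton _
  | step _ hs ih =>
    obtain ⟨F, hF⟩ := ih
    exact ⟨_, hF.step hs⟩

theorem Encodes.isFinal_iff (hT : Encodes G T F) :
    T.IsFinal ↔ Function.Injective (cls F) := by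
  unfold State.IsFinal
  rw [hT.nodes, Set.forall_mem_range]
  constructor
  · intro h x y hxy
    exact Finset.card_le_one.1 (h x) x (self_mem_cls F x) y (hxy ▸ self_mem_cls F y)
  · exact fun h x => Finset.card_le_one.2 fun y hy z hz =>
      h ((cls_eq_of_mem hy).trans (cls_eq_of_mem hz).symm)

/-- There are `L.length + 1` classes, and they number `|V|` exactly when `cls F` is injective. -/
theorem IsFamilyOf.isFinal_iff (hF : IsFamilyOf G L T F) :
    T.IsFinal ↔ L.length + 1 = Fintype.card V := by
  rw [hF.encodes.isFinal_iff, ← hF.ncard, ← Set.image_univ, ← Nat.card_eq_fintype_card,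
    ← Set.ncard_univ, Set.ncard_image_iff, Set.injOn_univ]

theorem cls_eq_singleton (hinj : Function.Injective (cls F)) (x : V) : cls F x = {x} := by
  ext y
  rw [Finset.mem_singleton]
  exact ⟨fun h => hinj (cls_eq_of_mem h), fun h => h ▸ self_mem_cls F y⟩

theorem Encodes.readsOff (hT : Encodes G T F) (hinj : Function.Injective (cls F)) :
    T.ReadsOff (toDirectedTree G F) := by
  unfold State.ReadsOff
  rw [hT.edges]
  ext e
  simp only [cls_eq_singleton hinj]
  constructor
  · rintro ⟨W, t, s, h, rfl⟩
    exact ⟨t, s, ⟨W, h⟩, by rw [h.toDirectedTree_cost]⟩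
  · rintro ⟨t, s, ⟨W, h⟩, rfl⟩
    exact ⟨W, t, s, h, by rw [h.toDirectedTree_cost]⟩

theorem isSmallestSCTree_toDirectedTree [Nonempty V] (hF : IsSmallestFamily G F)
    (hinj : Function.Injective (cls F)) : (toDirectedTree G F).IsSmallestSCTree G := by
  have hT := hF.isTreeFamily
  -- The invariant gives only some pair for `U`; with singleton classes, uniqueness of links makes
  -- it the edge itself.
  have hside : ∀ {U t s}, IsLink F U t s → G.SmallestSide s t U := fun {U t s} h => by
    obtain ⟨t', s', h', hs⟩ := hF.linked U h.1
    have he := IsAdj.cls_unique hT (.inl h) (.inl h') (iff_of_false h.2.2.1 h'.2.2.1)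
    rw [hinj he.1, hinj he.2]
    exact hs
  refine ⟨⟨exists_isRootedAt_toDirectedTree hT hinj, ?_⟩, ?_⟩
  · rintro t s ⟨U, h⟩
    rw [h.headSide_eq hT hinj]
    exact ⟨(hside h).isMinCut, h.toDirectedTree_cost⟩
  · rintro t s ⟨U, h⟩
    rw [h.headSide_eq hT hinj, ← (hside h).eq_SC]
    exact ⟨rfl, (hside h).card_le_SC⟩

theorem exists_run [Nonempty V] (G : WeightedGraph V) :
    ∀ k < Fintype.card V, ∃ L T, Run G L T ∧ L.length = k
  | 0, _ => ⟨[], _, .init, rfl⟩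
  | k + 1, hk => by
    obtain ⟨L, T, hL, rfl⟩ := exists_run G k (by omega)
    obtain ⟨F, hF⟩ := hL.exists_isFamilyOf
    have hT : ¬ T.IsFinal := fun h => by
      have := hF.isFinal_iff.1 h
      omega
    unfold State.IsFinal at hT
    push Not at hT
    obtain ⟨S, hS, hcard⟩ := hT
    obtain ⟨u, hu, v, hv, huv⟩ := Finset.one_lt_card.1 hcard
    obtain ⟨f, hf⟩ := exists_isMaxFlow G u v
    exact ⟨⟨u, v, f⟩ :: L, _, hL.step (.mk T S ⟨u, v, f⟩ hS hu hv huv hf), rfl⟩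

end GomoryHu

theorem theorem2 {V : Type*} [Fintype V] [DecidableEq V] [Nonempty V] (G : WeightedGraph V) :
    -- a rooted cut tree as claimed exists
    (∃ D : DirectedTree V, D.IsSmallestSCTree G) ∧
    -- the algorithm can construct one, with `n - 1` maximum-flow computations
    (∃ (L : List (GomoryHu.FlowCall V)) (T : GomoryHu.State V) (D : DirectedTree V),
      GomoryHu.Run G L T ∧ L.length + 1 = Fintype.card V ∧ T.IsFinal ∧ T.ReadsOff D ∧
        D.IsSmallestSCTree G) ∧
    -- and this does not depend on the choices that it makes
    ∀ (L : List (GomoryHu.FlowCall V)) (T : GomoryHu.State V), GomoryHu.Run G L T →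
      -- it stops exactly after `n - 1` maximum-flow computations
      (T.IsFinal ↔ L.length + 1 = Fintype.card V) ∧
      -- before that, any pair in any node can be treated next, and whatever maximum flow is
      -- found, the chosen cut does not cross the subtrees at this node
      (∀ S ∈ T.nodes, ∀ u ∈ S, ∀ v ∈ S, u ≠ v →
        (∃ f, G.IsMaxFlow u v f) ∧
        ∀ f, G.IsMaxFlow u v f → ∀ N, T.Adj S N →
          T.subtree S N ⊆ ((⟨u, v, f⟩ : GomoryHu.FlowCall V).side G : Set V) ∨
          Disjoint (T.subtree S N) ((⟨u, v, f⟩ : GomoryHu.FlowCall V).side G : Set V)) ∧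
      -- each flow yields both source communities of its pair, so a smallest one is chosen
      (∀ r ∈ L, G.sourceSide r.flow r.source = G.SC r.source {r.sink} ∧
        G.sinkSide r.flow r.sink = G.SC r.sink {r.source}) ∧
      -- the chosen cuts are non-crossing
      (∀ r ∈ L, ∀ r' ∈ L, r.side G ⊆ r'.side G ∨ r'.side G ⊆ r.side G ∨
        Disjoint (r.side G) (r'.side G)) ∧
      -- the final tree is as claimed, and the cuts it represents are exactly the chosen ones
      (T.IsFinal → ∃ D : DirectedTree V, T.ReadsOff D ∧ D.IsSmallestSCTree G ∧
        (∀ t s, D.Edge t s → ∃ r ∈ L, r.side G = D.headSide t s) ∧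
        (∀ r ∈ L, ∃ t s, D.Edge t s ∧ r.side G = D.headSide t s)) := by
  have hfinal : ∀ (L : List (GomoryHu.FlowCall V)) (T : GomoryHu.State V)
      (F : Finset (Finset V)), GomoryHu.IsFamilyOf G L T F → T.IsFinal →
      T.ReadsOff (SideFamily.toDirectedTree G F) ∧
        (SideFamily.toDirectedTree G F).IsSmallestSCTree G := fun L T F hF hT => by
    have hinj := hF.encodes.isFinal_iff.1 hT
    exact ⟨hF.encodes.readsOff hinj,
      GomoryHu.isSmallestSCTree_toDirectedTree hF.isSmallestFamily hinj⟩
  have hrun : ∃ (L : List (GomoryHu.FlowCall V)) (T : GomoryHu.State V) (D : DirectedTree V),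
      GomoryHu.Run G L T ∧ L.length + 1 = Fintype.card V ∧ T.IsFinal ∧ T.ReadsOff D ∧
        D.IsSmallestSCTree G := by
    have hpos : 0 < Fintype.card V := Fintype.card_pos
    obtain ⟨L, T, hL, hk⟩ := GomoryHu.exists_run G (Fintype.card V - 1) (by omega)
    obtain ⟨F, hF⟩ := hL.exists_isFamilyOf
    have hlen : L.length + 1 = Fintype.card V := by omega
    have hT := hF.isFinal_iff.2 hlen
    exact ⟨L, T, _, hL, hlen, hT, hfinal L T F hF hT⟩
  refine ⟨?_, hrun, fun L T hL => ?_⟩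
  · obtain ⟨L, T, D, -, -, -, -, hD⟩ := hrun
    exact ⟨D, hD⟩
  obtain ⟨F, hF⟩ := hL.exists_isFamilyOf
  refine ⟨hF.isFinal_iff, fun S hS u hu v hv huv => ⟨G.exists_isMaxFlow u v,
    fun f hf N hN => ?_⟩, fun r hr => ?_, fun r hr r' hr' => ?_, fun hT => ?_⟩
  · obtain ⟨a, ha, b, hb, hU⟩ :=
      GomoryHu.FlowCall.exists_smallestSide (r := ⟨u, v, f⟩) hf huv hu hv
    have hSa := hF.encodes.eq_cls hS ha
    have hab : SideFamily.cls F a = SideFamily.cls F b := hSa ▸ hF.encodes.eq_cls hS hb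
    rw [hSa] at hN ⊢
    exact hF.encodes.subtree_subset_or_disjoint hF.isSmallestFamily hU hab hN
  · obtain ⟨hne, hmax⟩ := hF.isMaxFlow r hr
    exact ⟨(hmax.isCommunityCut_sourceSide hne).eq_SC, (hmax.isCommunityCut_sinkSide hne).eq_SC⟩
  · exact hF.isSmallestFamily.laminar _ ((hF.mem_iff _).2 ⟨r, hr, rfl⟩) _
      ((hF.mem_iff _).2 ⟨r', hr', rfl⟩)
  · have hinj := hF.encodes.isFinal_iff.1 hT
    obtain ⟨h1, h2⟩ := hfinal L T F hF hT
    refine ⟨_, h1, h2, ?_, fun r hr => ?_⟩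
    · rintro t s ⟨U, h⟩
      rw [h.headSide_eq hF.isSmallestFamily.isTreeFamily hinj]
      exact (hF.mem_iff U).1 h.1
    · obtain ⟨t, s, h, -⟩ := hF.isSmallestFamily.linked _ ((hF.mem_iff _).2 ⟨r, hr, rfl⟩)
      exact ⟨t, s, ⟨_, h⟩, (h.headSide_eq hF.isSmallestFamily.isTreeFamily hinj).symm⟩
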